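/- **Setting.** Let $I=(0,1)$ and $V_k(t)=\sqrt2\sin((\tfrac\pi2+k\pi)t)$, $W_k(t)=\sqrt2\cos((\tfrac\pi2+k\pi)t)$, $\lambda_k=\tfrac{\pi^2}{4}(2k+1)^2$ for $k\in\mathbb N_0$. For a real Hilbert space $H$, let $H^{1/2}_{0,}(I;H)$ be the space of all $v\in L^2(I;H)$ with $$\|v\|_{H^{1/2}_{0,}(I;H)}^2:=\sum_k\lambda_k^{1/2}\Big\|\int_I V_k v\,dt\Big\|_H^2<\infty,$$ and let $H^{1/2}_{,0}(I;H)$ be defined in the same way with $W_k$ in place of $V_k$. For $g\in L^2(I;H)$ let $\|g\|_{[H^{1/2}_{,0}(I;H)]'}$ be the norm of the functional $w\mapsto\langle g,w\rangle_{L^2(I;H)}$ on $H^{1/2}_{,0}(I;H)$. The modified Hilbert transform is $\mathcal H_Tz=\sum_k z_kW_k$ with $z_k=\int_I V_kz\,dt\in H$. Let $\Omega\subset\mathbb R^n$ be a bounded domain (for instance a bounded polytopal Lipschitz domain, $n\in\{1,2,3\}$), let $\Gamma_D\subset\partial\Omega$ be closed and nonempty, and put $Q=\Omega\times I$. Let $H^1_{\Gamma_D}(\Omega)$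 be the closure in $H^1(\Omega)$ of the restrictions to $\Omega$ of functions in $C_c^\infty(\mathbb R^n)$ whose support does not meet $\Gamma_D$. Let $A\in L^\infty(\Omega;\mathbb R^{n\times n}_{\rm sym})$ be uniformly positive definite. Put $$X=L^2(I;H^1_{\Gamma_D}(\Omega))\cap H^{1/2}_{0,}(I;L^2(\Omega)),\qquad Y=L^2(I;H^1_{\Gamma_D}(\Omega))\cap H^{1/2}_{,0}(I;L^2(\Omega)),$$ $$b(v,w)=\langle\partial_tv,w\rangle_Q+\langle A\nabla_xv,\nabla_xw\rangle_{L^2(Q)^n}\qquad(v\in X,\ w\in Y),$$ where $\langle\partial_t v,w\rangle_Q$ is the continuous extension of the $L^2(Q)$ inner product, that is, $\langle\partial_tv,w\rangle_Q=\sum_k\lambda_k^{1/2}\langle \int_I V_kv\,dt,\int_I W_kw\,dt\rangle_{L^2(\Omega)}$. **Discretization.** Let $N\ge1$ and $d\ge 0$ be integers, and let $S^t$ be the space of continuous functions on $[0,1]$ that vanish at $t=0$ and are polynomials of degree less than $d$ on each interval $[\frac{l}{N},\frac{l+1}{N}]$, $0\le l<N$. Given a decomposition of $\Omega$ into finitely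 many pairwise disjoint open elements $\tau\subset\Omega$ whose closures cover $\overline\Omega$, and $p\in\mathbb N_0$, let $S^x$ be the space of all functions in $H^1_{\Gamma_D}(\Omega)$ that are continuous on $\overline\Omega$, vanish on $\Gamma_D$ and coincide with a polynomial of degree at most $p$ on $\overline\tau$ for each element $\tau$. Put $S=S^x\otimes S^t$ (algebraic tensor product). **Theorem 3.1.** Let $f\in Y'$ and let $u\in X$ satisfy $b(u,w)=\langle f,w\rangle_Q$ for all $w\in Y$. Assume that $\mathcal L_xu\in L^2(Q)$, i.e. that there is a function $\mathcal L_xu\in L^2(Q)$ with $\langle A\nabla_xu,\nabla_xw\rangle_{L^2(Q)^n}=\langle\mathcal L_xu,w\rangle_{L^2(Q)}$ for all $w\in Y$. Let $u_h\in S$ satisfy $$b(u_h,\mathcal H_Tv)=\langle f,\mathcal H_Tv\rangle_Q\qquad\text{for all }v\in S.$$ Let $P^t:L^2(I)\to S^t$ be any bounded linear projection onto $S^t$, and let $P^x:H^1_{\Gamma_D}(\Omega)\to S^x$ be the Ritz projection, i.e. $P^x$ is linear and $\langle A\nabla P^xz,\nabla w\rangle_{L^2(\Omega)^n}=\langle A\nabla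 z,\nabla w\rangle_{L^2(\Omega)^n}$ for all $z\in H^1_{\Gamma_D}(\Omega)$ and $w\in S^x$. Then $S\subset X$, $(P^t\otimes P^x)u\in S$, and $$\|u-u_h\|_{H^{1/2}_{0,}(I;L^2(\Omega))}\le 2\,\|u-(P^t\otimes P^x)u\|_{H^{1/2}_{0,}(I;L^2(\Omega))}+\big\|(\mathrm{Id}-P^t\otimes\mathrm{Id}_x)\mathcal L_xu\big\|_{[H^{1/2}_{,0}(I;L^2(\Omega))]'} .$$ -/

import Mathlib

open MeasureTheory Set Filter
open scoped ENNReal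

noncomputable section

namespace SpaceTimeHeat

/-! ### The time interval -/

/-- Lebesgue measure on the time interval `I = (0, 1)`. -/
abbrev timeMeas : Measure ℝ := volume.restrict (Ioo (0 : ℝ) 1)

/-- The Bochner space `L²(I; H)`. -/
abbrev L2T (H : Type*) [NormedAddCommGroup H] : Type _ := Lp H 2 timeMeas

section Time

variable {H K : Type*} [NormedAddCommGroup H] [InnerProductSpace ℝ H]
  [NormedAddCommGroup K] [InnerProductSpace ℝ K]

/-- The elementary tensor `φ ⊗ h`, i.e. the function `t ↦ φ(t) h`. -/
def dyad (φ : L2T ℝ) (h : H) : L2T H :=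
  (ContinuousLinearMap.toSpanSingleton ℝ h).compLp φ

/-- The coefficient `∫_I φ(t) u(t) dt ∈ H` of `u ∈ L²(I; H)` with respect to `φ ∈ L²(I)`. -/
def coeff (φ : L2T ℝ) (u : L2T H) : H := ∫ t, φ t • u t ∂timeMeas

lemma coeFn_dyad (φ : L2T ℝ) (h : H) : dyad φ h =ᵐ[timeMeas] fun t => φ t • h := by
  filter_upwards [ContinuousLinearMap.coeFn_compLp
    (ContinuousLinearMap.toSpanSingleton ℝ h) φ] with t ht
  simpa [dyad] using ht

lemma integrable_coeff (φ : L2T ℝ) (u : L2T H) :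
    Integrable (fun t => φ t • u t) timeMeas := by
  have h := (Lp.memLp u).smul (Lp.memLp φ) (r := 1)
  exact memLp_one_iff_integrable.1 h

lemma coeff_add (φ : L2T ℝ) (u v : L2T H) : coeff φ (u + v) = coeff φ u + coeff φ v := by
  unfold coeff
  rw [← integral_add (integrable_coeff φ u) (integrable_coeff φ v)]
  refine integral_congr_ae ?_
  filter_upwards [Lp.coeFn_add u v] with t ht
  rw [ht, Pi.add_apply, smul_add]

lemma coeff_smul (φ : L2T ℝ) (c : ℝ) (u : L2T H) : coeff φ (c • u) = c • coeff φ u := by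
  unfold coeff
  rw [← integral_smul]
  refine integral_congr_ae ?_
  filter_upwards [Lp.coeFn_smul c u] with t ht
  rw [ht, Pi.smul_apply, smul_comm]

lemma inner_dyad [CompleteSpace H] (φ : L2T ℝ) (h : H) (u : L2T H) :
    inner ℝ (dyad φ h) u = inner ℝ h (coeff φ u) := by
  unfold coeff
  rw [← integral_inner (integrable_coeff φ u), L2.inner_def]
  refine integral_congr_ae ?_
  filter_upwards [coeFn_dyad φ h] with t ht
  simp [ht, inner_smul_left, inner_smul_right]

lemma inner_dyad_dyad [CompleteSpace H] (φ ψ : L2T ℝ) (h k : H) :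
    inner ℝ (dyad φ h) (dyad ψ k) = inner ℝ φ ψ * inner ℝ h k := by
  rw [L2.inner_def, L2.inner_def, ← integral_mul_const]
  refine integral_congr_ae ?_
  filter_upwards [coeFn_dyad φ h, coeFn_dyad ψ k] with t h1 h2
  simp [h1, h2, inner_smul_left, inner_smul_right]
  ring

lemma coeff_dyad [CompleteSpace H] (φ ψ : L2T ℝ) (h : H) :
    coeff φ (dyad ψ h) = (inner ℝ φ ψ : ℝ) • h := by
  refine ext_inner_left ℝ fun k => ?_
  rw [← inner_dyad, inner_dyad_dyad, inner_smul_right]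

lemma coeff_compLp [CompleteSpace H] [CompleteSpace K] (L : H →L[ℝ] K) (φ : L2T ℝ) (u : L2T H) :
    coeff φ (L.compLp u) = L (coeff φ u) := by
  unfold coeff
  rw [← L.integral_comp_comm (integrable_coeff φ u)]
  refine integral_congr_ae ?_
  filter_upwards [L.coeFn_compLp u] with t ht
  simp [ht]

lemma compLp_dyad (L : H →L[ℝ] K) (φ : L2T ℝ) (h : H) :
    L.compLp (dyad φ h) = dyad φ (L h) := by
  apply Lp.ext
  filter_upwards [coeFn_dyad φ h, coeFn_dyad φ (L h), L.coeFn_compLp (dyad φ h)] with t h1 h2 h3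
  simp [h1, h2, h3]

/-! ### The two eigensystems and the spaces `H^{1/2}_{0,}(I; H)`, `H^{1/2}_{,0}(I; H)` -/

/-- The eigenvalues `λ_k = π²/4 (2k+1)²` of `-∂_tt` with mixed boundary conditions. -/
def eigval (k : ℕ) : ℝ := Real.pi ^ 2 / 4 * (2 * (k : ℝ) + 1) ^ 2

/-- `V_k(t) = √2 sin((π/2 + kπ) t)`, with `V_k(0) = 0 = V_k'(1)`. -/
def sinMode (k : ℕ) (t : ℝ) : ℝ := √2 * Real.sin ((Real.pi / 2 + k * Real.pi) * t)

/-- `W_k(t) = √2 cos((π/2 + kπ) t)`, with `W_k'(0) = 0 = W_k(1)`. -/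
def cosMode (k : ℕ) (t : ℝ) : ℝ := √2 * Real.cos ((Real.pi / 2 + k * Real.pi) * t)

lemma memLp_timeMeas_of_continuous {f : ℝ → ℝ} (hf : Continuous f) : MemLp f 2 timeMeas := by
  obtain ⟨C, hC⟩ := (isCompact_Icc (a := (0 : ℝ)) (b := 1)).exists_bound_of_continuousOn
    hf.continuousOn
  refine MemLp.of_bound hf.aestronglyMeasurable C ?_
  filter_upwards [ae_restrict_mem measurableSet_Ioo] with t ht
  exact hC t ⟨ht.1.le, ht.2.le⟩

lemma continuous_sinMode (k : ℕ) : Continuous (sinMode k) := by unfold sinMode; fun_prop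

lemma continuous_cosMode (k : ℕ) : Continuous (cosMode k) := by unfold cosMode; fun_prop

/-- `V_k` as an element of `L²(I)`. -/
def sinL (k : ℕ) : L2T ℝ := (memLp_timeMeas_of_continuous (continuous_sinMode k)).toLp _

/-- `W_k` as an element of `L²(I)`. -/
def cosL (k : ℕ) : L2T ℝ := (memLp_timeMeas_of_continuous (continuous_cosMode k)).toLp _

/-- For an orthonormal sequence `e` in `L²(I)`, the space of all `u ∈ L²(I; H)` with
`∑_k λ_k^{1/2} ‖u_k‖² < ∞`, where `u_k = ∫_I e_k(t) u(t) dt`.  With `e = sinL` this is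
`H^{1/2}_{0,}(I; H)`, with `e = cosL` it is `H^{1/2}_{,0}(I; H)`. -/
def halfSpace (e : ℕ → L2T ℝ) (H : Type*) [NormedAddCommGroup H] [InnerProductSpace ℝ H] :
    Submodule ℝ (L2T H) where
  carrier := {u | Summable fun k => √(eigval k) * ‖coeff (e k) u‖ ^ 2}
  zero_mem' := by
    have h0 : ∀ k, coeff (e k) (0 : L2T H) = 0 := fun k => by
      simpa using coeff_smul (e k) 0 (0 : L2T H)
    simp only [mem_ofPred_eq, h0]
    simp
  add_mem' := by
    intro u v hu hv
    simp only [mem_ofPred_eq, coeff_add] at *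
    refine Summable.of_nonneg_of_le (fun k => by positivity) (fun k => ?_)
      ((hu.mul_left 2).add (hv.mul_left 2))
    have h1 := norm_add_le (coeff (e k) u) (coeff (e k) v)
    have h2 : ‖coeff (e k) u + coeff (e k) v‖ ^ 2
        ≤ 2 * ‖coeff (e k) u‖ ^ 2 + 2 * ‖coeff (e k) v‖ ^ 2 := by
      nlinarith [sq_nonneg (‖coeff (e k) u‖ - ‖coeff (e k) v‖),
        norm_nonneg (coeff (e k) u + coeff (e k) v)]
    nlinarith [mul_le_mul_of_nonneg_left h2 (Real.sqrt_nonneg (eigval k))]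
  smul_mem' := by
    intro c u hu
    simp only [mem_ofPred_eq, coeff_smul, norm_smul, mul_pow] at *
    refine (hu.mul_left (‖c‖ ^ 2)).congr fun k => ?_
    ring

/-- The interpolation norm `(∑_k λ_k^{1/2} ‖u_k‖²)^{1/2}` on `halfSpace e H`. -/
def halfNorm (e : ℕ → L2T ℝ) (u : L2T H) : ℝ :=
  √(∑' k, √(eigval k) * ‖coeff (e k) u‖ ^ 2)

/-- The duality pairing `⟨∂_t v, w⟩` for `v ∈ H^{1/2}_{0,}(I; H)` and `w ∈ H^{1/2}_{,0}(I; H)`, the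
continuous extension of the inner product of `L²(I; H)`.  Since `V_k' = √λ_k W_k`, the derivative of
`v = ∑_k V_k ⊗ v_k` is `∑_k √λ_k W_k ⊗ v_k`, which is then paired with `w = ∑_k W_k ⊗ w_k`. -/
def derivPairing (v w : L2T H) : ℝ :=
  ∑' k, √(eigval k) * inner ℝ (coeff (sinL k) v) (coeff (cosL k) w)

/-- The modified Hilbert transform `∑_k V_k ⊗ z_k ↦ ∑_k W_k ⊗ z_k` on `L²(I; H)`. -/
def hilbertT (z : L2T H) : L2T H := ∑' k, dyad (cosL k) (coeff (sinL k) z)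

/-- The norm of the functional `w ↦ ⟨g, w⟩_{L²(I; H)}` in the dual of `H^{1/2}_{,0}(I; H)`. -/
def dualHalfNorm (g : L2T H) : ℝ :=
  sSup {r | ∃ w ∈ halfSpace cosL H, halfNorm cosL w ≤ 1 ∧ r = inner ℝ g w}

/-! ### Orthonormality, completeness and consistency -/

lemma integral_cos_mul (m : ℤ) (hm : m ≠ 0) :
    ∫ t in (0 : ℝ)..1, Real.cos (m * Real.pi * t) = 0 := by
  have h : (m * Real.pi : ℝ) ≠ 0 := by positivity
  rw [intervalIntegral.integral_comp_mul_left (fun x => Real.cos x) h]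
  simp [Real.sin_int_mul_pi]

lemma integral_timeMeas {E : Type*} [NormedAddCommGroup E] [NormedSpace ℝ E] (f : ℝ → E) :
    ∫ t, f t ∂timeMeas = ∫ t in (0 : ℝ)..1, f t := by
  rw [intervalIntegral.integral_of_le zero_le_one, integral_Ioc_eq_integral_Ioo]

lemma coeFn_sinL (k : ℕ) : sinL k =ᵐ[timeMeas] sinMode k := MemLp.coeFn_toLp _

lemma coeFn_cosL (k : ℕ) : cosL k =ᵐ[timeMeas] cosMode k := MemLp.coeFn_toLp _

lemma inner_cosL (j k : ℕ) : inner ℝ (cosL j) (cosL k) = if j = k then (1 : ℝ) else 0 := by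
  have h : inner ℝ (cosL j) (cosL k) = ∫ t in (0 : ℝ)..1,
      (Real.cos (((j - k : ℤ) : ℝ) * Real.pi * t) + Real.cos (((j + k + 1 : ℤ) : ℝ) * Real.pi * t)) := by
    rw [L2.inner_def, ← integral_timeMeas]
    refine integral_congr_ae ?_
    filter_upwards [coeFn_cosL j, coeFn_cosL k] with t h1 h2
    have h3 := Real.mul_self_sqrt (show (0 : ℝ) ≤ 2 by norm_num)
    have e1 : ((j - k : ℤ) : ℝ) * Real.pi * t = (Real.pi / 2 + j * Real.pi) * t
      - (Real.pi / 2 + k * Real.pi) * t := by push_cast; ring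
    have e2 : ((j + k + 1 : ℤ) : ℝ) * Real.pi * t = (Real.pi / 2 + j * Real.pi) * t
      + (Real.pi / 2 + k * Real.pi) * t := by push_cast; ring
    rw [h1, h2, e1, e2, Real.cos_sub, Real.cos_add]
    simp only [cosMode, RCLike.inner_apply, conj_trivial]
    linear_combination (Real.cos ((Real.pi / 2 + j * Real.pi) * t)
      * Real.cos ((Real.pi / 2 + k * Real.pi) * t)) * h3
  rw [h, intervalIntegral.integral_add (Continuous.intervalIntegrable (by fun_prop) _ _)
    (Continuous.intervalIntegrable (by fun_prop) _ _), integral_cos_mul (j + k + 1) (by omega)]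
  split_ifs with hjk
  · subst hjk; simp
  · rw [integral_cos_mul _ (by omega)]; simp

lemma inner_sinL (j k : ℕ) : inner ℝ (sinL j) (sinL k) = if j = k then (1 : ℝ) else 0 := by
  have h : inner ℝ (sinL j) (sinL k) = ∫ t in (0 : ℝ)..1,
      (Real.cos (((j - k : ℤ) : ℝ) * Real.pi * t) - Real.cos (((j + k + 1 : ℤ) : ℝ) * Real.pi * t)) := by
    rw [L2.inner_def, ← integral_timeMeas]
    refine integral_congr_ae ?_
    filter_upwards [coeFn_sinL j, coeFn_sinL k] with t h1 h2
    have h3 := Real.mul_self_sqrt (show (0 : ℝ) ≤ 2 by norm_num)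
    have e1 : ((j - k : ℤ) : ℝ) * Real.pi * t = (Real.pi / 2 + j * Real.pi) * t
      - (Real.pi / 2 + k * Real.pi) * t := by push_cast; ring
    have e2 : ((j + k + 1 : ℤ) : ℝ) * Real.pi * t = (Real.pi / 2 + j * Real.pi) * t
      + (Real.pi / 2 + k * Real.pi) * t := by push_cast; ring
    rw [h1, h2, e1, e2, Real.cos_sub, Real.cos_add]
    simp only [sinMode, RCLike.inner_apply, conj_trivial]
    linear_combination (Real.sin ((Real.pi / 2 + j * Real.pi) * t)
      * Real.sin ((Real.pi / 2 + k * Real.pi) * t)) * h3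
  rw [h, intervalIntegral.integral_sub (Continuous.intervalIntegrable (by fun_prop) _ _)
    (Continuous.intervalIntegrable (by fun_prop) _ _), integral_cos_mul (j + k + 1) (by omega)]
  split_ifs with hjk
  · subst hjk; simp
  · rw [integral_cos_mul _ (by omega)]; simp

lemma norm_sum_dyad_sq [CompleteSpace H] {e : ℕ → L2T ℝ}
    (he : ∀ j k, inner ℝ (e j) (e k) = if j = k then (1 : ℝ) else 0) (s : Finset ℕ) (z : ℕ → H) :
    ‖∑ k ∈ s, dyad (e k) (z k)‖ ^ 2 = ∑ k ∈ s, ‖z k‖ ^ 2 := by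
  rw [← real_inner_self_eq_norm_sq, sum_inner]
  refine Finset.sum_congr rfl fun j hj => ?_
  rw [inner_sum]
  simp only [inner_dyad_dyad, he]
  simp [hj]

/-- Bessel's inequality. -/
lemma summable_norm_coeff_sq [CompleteSpace H] {e : ℕ → L2T ℝ}
    (he : ∀ j k, inner ℝ (e j) (e k) = if j = k then (1 : ℝ) else 0) (u : L2T H) :
    Summable fun k => ‖coeff (e k) u‖ ^ 2 := by
  refine summable_of_sum_le (c := ‖u‖ ^ 2) (fun k => by positivity) fun s => ?_
  set S := ∑ k ∈ s, dyad (e k) (coeff (e k) u) with hS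
  have h1 : ‖S‖ ^ 2 = ∑ k ∈ s, ‖coeff (e k) u‖ ^ 2 := norm_sum_dyad_sq he s _
  have h2 : inner ℝ S u = ∑ k ∈ s, ‖coeff (e k) u‖ ^ 2 := by
    rw [hS, sum_inner]
    simp [inner_dyad]
  have h3 := real_inner_le_norm S u
  rw [← h1] at h2 ⊢
  nlinarith [norm_nonneg S, norm_nonneg u, sq_nonneg (‖S‖ - ‖u‖)]

lemma summable_dyad [CompleteSpace H] {e : ℕ → L2T ℝ}
    (he : ∀ j k, inner ℝ (e j) (e k) = if j = k then (1 : ℝ) else 0) {z : ℕ → H}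
    (hz : Summable fun k => ‖z k‖ ^ 2) : Summable fun k => dyad (e k) (z k) := by
  rw [summable_iff_vanishing_norm] at hz ⊢
  intro ε hε
  obtain ⟨s, hs⟩ := hz (ε ^ 2) (by positivity)
  refine ⟨s, fun t ht => ?_⟩
  have h := hs t ht
  rw [← norm_sum_dyad_sq he, Real.norm_of_nonneg (by positivity)] at h
  exact lt_of_pow_lt_pow_left₀ 2 hε.le h

lemma hasSum_hilbertT [CompleteSpace H] (z : L2T H) :
    HasSum (fun k => dyad (cosL k) (coeff (sinL k) z)) (hilbertT z) :=
  (summable_dyad inner_cosL (summable_norm_coeff_sq inner_sinL z)).hasSum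

/-- The defining property of the modified Hilbert transform. -/
lemma coeff_cosL_hilbertT [CompleteSpace H] (k : ℕ) (z : L2T H) :
    coeff (cosL k) (hilbertT z) = coeff (sinL k) z := by
  refine ext_inner_left ℝ fun h => ?_
  rw [← inner_dyad]
  have h1 := (hasSum_hilbertT z).mapL (innerSL ℝ (dyad (cosL k) h))
  have h2 : HasSum (fun j => (innerSL ℝ (dyad (cosL k) h)) (dyad (cosL j) (coeff (sinL j) z)))
      (inner ℝ h (coeff (sinL k) z)) := by
    convert hasSum_ite_eq k (inner ℝ h (coeff (sinL k) z)) using 2 with j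
    simp only [innerSL_apply_apply, inner_dyad_dyad, inner_cosL]
    by_cases hj : j = k
    · subst hj; simp
    · simp [hj, Ne.symm hj]
  exact h1.unique h2

lemma integral_mul_cos_eq_zero {f : L2T ℝ} (hf : ∀ k, inner ℝ (cosL k) f = 0) (k : ℤ) :
    ∫ t, f t * Real.cos ((k + 1 / 2) * Real.pi * t) ∂timeMeas = 0 := by
  have hnat : ∀ n : ℕ, ∫ t, f t * Real.cos ((n + 1 / 2) * Real.pi * t) ∂timeMeas = 0 := by
    intro n
    have h := hf n
    rw [L2.inner_def] at h
    have h2 : ∫ t, inner ℝ (cosL n t) (f t) ∂timeMeas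
        = √2 * ∫ t, f t * Real.cos ((n + 1 / 2) * Real.pi * t) ∂timeMeas := by
      rw [← integral_const_mul]
      refine integral_congr_ae ?_
      filter_upwards [coeFn_cosL n] with t h1
      rw [h1]
      have e1 : (Real.pi / 2 + n * Real.pi) * t = (n + 1 / 2) * Real.pi * t := by ring
      simp only [cosMode, e1, RCLike.inner_apply, conj_trivial]
      ring
    rw [h2] at h
    simpa using h
  rcases Int.le_total 0 k with h | h
  · obtain ⟨n, rfl⟩ := Int.eq_ofNat_of_zero_le h
    simpa using hnat n
  · rcases eq_or_lt_of_le h with h | h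
    · subst h; simpa using hnat 0
    · obtain ⟨n, hn⟩ := Int.eq_ofNat_of_zero_le (show 0 ≤ -k - 1 by omega)
      have hk : (k : ℝ) = -(n : ℝ) - 1 := by
        have : k = -(n : ℤ) - 1 := by omega
        rw [this]; push_cast; ring
      rw [← hnat n]
      refine integral_congr_ae (Eventually.of_forall fun t => ?_)
      have e1 : ((k : ℝ) + 1 / 2) * Real.pi * t = -(((n : ℝ) + 1 / 2) * Real.pi * t) := by
        rw [hk]; ring
      simp only [e1, Real.cos_neg]

lemma integrable_mul_continuous (f : L2T ℝ) {g : ℝ → ℝ} (hg : Continuous g) :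
    Integrable (fun t => f t * g t) timeMeas :=
  (Lp.memLp f).integrable_mul (memLp_timeMeas_of_continuous hg)

lemma integral_mul_cos_pow_eq_zero {f : L2T ℝ} (hf : ∀ k, inner ℝ (cosL k) f = 0) (m : ℕ) :
    ∀ k : ℤ, ∫ t, f t * (Real.cos (Real.pi / 2 * t) * Real.cos (Real.pi * t) ^ m
      * Real.cos (k * Real.pi * t)) ∂timeMeas = 0 := by
  induction m with
  | zero =>
    intro k
    have h1 := integral_mul_cos_eq_zero hf k
    have h2 := integral_mul_cos_eq_zero hf (k - 1)
    have h3 : ∫ t, (f t * Real.cos ((k + 1 / 2) * Real.pi * t)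
        + f t * Real.cos (((k - 1 : ℤ) + 1 / 2) * Real.pi * t)) ∂timeMeas = 0 := by
      rw [integral_add (integrable_mul_continuous f (by fun_prop))
        (integrable_mul_continuous f (by fun_prop)), h1, h2, add_zero]
    rw [← mul_zero (1 / 2 : ℝ), ← h3, ← integral_const_mul]
    refine integral_congr_ae (Eventually.of_forall fun t => ?_)
    have e1 : ((k : ℝ) + 1 / 2) * Real.pi * t = k * Real.pi * t + Real.pi / 2 * t := by ring
    have e2 : (((k - 1 : ℤ) : ℝ) + 1 / 2) * Real.pi * t = k * Real.pi * t - Real.pi / 2 * t := by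
      push_cast; ring
    simp only [e1, e2, Real.cos_add, Real.cos_sub]
    ring
  | succ m ih =>
    intro k
    have h1 := ih (k + 1)
    have h2 := ih (k - 1)
    have h3 : ∫ t, (f t * (Real.cos (Real.pi / 2 * t) * Real.cos (Real.pi * t) ^ m
        * Real.cos ((k + 1 : ℤ) * Real.pi * t)) + f t * (Real.cos (Real.pi / 2 * t)
        * Real.cos (Real.pi * t) ^ m * Real.cos ((k - 1 : ℤ) * Real.pi * t))) ∂timeMeas = 0 := by
      rw [integral_add (integrable_mul_continuous f (by fun_prop))
        (integrable_mul_continuous f (by fun_prop)), h1, h2, add_zero]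
    rw [← mul_zero (1 / 2 : ℝ), ← h3, ← integral_const_mul]
    refine integral_congr_ae (Eventually.of_forall fun t => ?_)
    have e1 : ((k + 1 : ℤ) : ℝ) * Real.pi * t = k * Real.pi * t + Real.pi * t := by push_cast; ring
    have e2 : ((k - 1 : ℤ) : ℝ) * Real.pi * t = k * Real.pi * t - Real.pi * t := by push_cast; ring
    simp only [e1, e2, Real.cos_add, Real.cos_sub]
    ring

/-- The functions `W_k` are total in `L²(I)`. -/
lemma eq_zero_of_inner_cosL {f : L2T ℝ} (hf : ∀ k, inner ℝ (cosL k) f = 0) : f = 0 := by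
  set F : ℝ → ℝ := fun t => f t * Real.cos (Real.pi / 2 * t) with hF
  have hFi : Integrable F timeMeas := integrable_mul_continuous f (by fun_prop)
  have hpoly : ∀ p : Polynomial ℝ, ∫ t, F t * p.eval (Real.cos (Real.pi * t)) ∂timeMeas = 0 := by
    intro p
    have e : ∀ t, F t * p.eval (Real.cos (Real.pi * t)) = ∑ m ∈ Finset.range (p.natDegree + 1),
        p.coeff m * (f t * (Real.cos (Real.pi / 2 * t) * Real.cos (Real.pi * t) ^ m
          * Real.cos ((0 : ℤ) * Real.pi * t))) := by
      intro t
      rw [Polynomial.eval_eq_sum_range, Finset.mul_sum]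
      refine Finset.sum_congr rfl fun m _ => ?_
      simp [hF]; ring
    simp_rw [e]
    rw [integral_finsetSum _ fun m _ =>
      (integrable_mul_continuous f (by fun_prop)).const_mul _]
    refine Finset.sum_eq_zero fun m _ => ?_
    rw [integral_const_mul, integral_mul_cos_pow_eq_zero hf m 0, mul_zero]
  have hcont : ∀ G : ℝ → ℝ, Continuous G → ∫ t, F t * G t ∂timeMeas = 0 := by
    intro G hG
    have hb : ∀ ε > 0, ‖∫ t, F t * G t ∂timeMeas‖ ≤ ε * ∫ t, ‖F t‖ ∂timeMeas := by
      intro ε hε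
      obtain ⟨p, hp⟩ := exists_polynomial_near_of_continuousOn (-1) 1
        (fun x => G (Real.arccos x / Real.pi))
        (hG.comp (Real.continuous_arccos.div_const _)).continuousOn ε hε
      have hGm : Integrable (fun t => F t * G t) timeMeas := by
        have := integrable_mul_continuous f (g := fun t => Real.cos (Real.pi / 2 * t) * G t)
          (by fun_prop)
        simpa [hF, mul_assoc] using this
      have hPm : Integrable (fun t => F t * p.eval (Real.cos (Real.pi * t))) timeMeas := by
        have := integrable_mul_continuous f
          (g := fun t => Real.cos (Real.pi / 2 * t) * p.eval (Real.cos (Real.pi * t)))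
          (by fun_prop)
        simpa [hF, mul_assoc] using this
      have h1 : ∫ t, F t * G t ∂timeMeas
          = ∫ t, (F t * G t - F t * p.eval (Real.cos (Real.pi * t))) ∂timeMeas := by
        rw [integral_sub hGm hPm, hpoly, sub_zero]
      rw [h1, ← integral_const_mul]
      refine norm_integral_le_of_norm_le (hFi.norm.const_mul ε) ?_
      filter_upwards [ae_restrict_mem measurableSet_Ioo] with t ht
      have h2 := hp (Real.cos (Real.pi * t)) ⟨Real.neg_one_le_cos _, Real.cos_le_one _⟩
      rw [Real.arccos_cos (mul_nonneg Real.pi_pos.le ht.1.le)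
        (mul_le_of_le_one_right Real.pi_pos.le ht.2.le),
        mul_div_cancel_left₀ _ Real.pi_ne_zero, abs_sub_comm] at h2
      rw [← mul_sub, norm_mul, mul_comm]
      exact mul_le_mul_of_nonneg_right h2.le (norm_nonneg _)
    by_contra hne
    have hpos : 0 < ‖∫ t, F t * G t ∂timeMeas‖ := norm_pos_iff.2 hne
    set C := ∫ t, ‖F t‖ ∂timeMeas
    have hC : 0 ≤ C := integral_nonneg fun t => norm_nonneg _
    have h := hb (‖∫ t, F t * G t ∂timeMeas‖ / (2 * (C + 1))) (by positivity)
    rw [div_mul_eq_mul_div, le_div_iff₀ (by positivity)] at h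
    nlinarith
  have hF0 : ∀ᵐ t ∂volume, t ∈ Ioo (0 : ℝ) 1 → F t = 0 := by
    refine isOpen_Ioo.ae_eq_zero_of_integral_contDiff_smul_eq_zero
      (IntegrableOn.locallyIntegrableOn hFi) fun g hg _ hgs => ?_
    rw [← hcont g hg.continuous]
    have e : (fun t => g t • F t) = (Ioo (0 : ℝ) 1).indicator (fun t => F t * g t) := by
      funext t
      by_cases ht : t ∈ Ioo (0 : ℝ) 1
      · rw [indicator_of_mem ht, smul_eq_mul, mul_comm]
      · rw [indicator_of_notMem ht, image_eq_zero_of_notMem_tsupport fun h => ht (hgs h), zero_smul]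
    rw [e, integral_indicator measurableSet_Ioo]
  refine Lp.eq_zero_iff_ae_eq_zero.2 ?_
  filter_upwards [(ae_restrict_iff' measurableSet_Ioo).2 hF0,
    ae_restrict_mem measurableSet_Ioo] with t h1 h2
  have h3 : 0 < Real.cos (Real.pi / 2 * t) :=
    Real.cos_pos_of_mem_Ioo ⟨by nlinarith [Real.pi_pos, h2.1], by nlinarith [Real.pi_pos, h2.2]⟩
  exact (mul_eq_zero.1 h1).resolve_right h3.ne'

lemma eq_zero_of_coeff_cosL [CompleteSpace H] {u : L2T H} (hu : ∀ k, coeff (cosL k) u = 0) :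
    u = 0 := by
  refine Lp.eq_zero_iff_ae_eq_zero.2 ?_
  have hui : Integrable u timeMeas := (Lp.memLp u).integrable one_le_two
  refine hui.ae_eq_zero_of_forall_setIntegral_eq_zero fun s hs _ => ?_
  refine ext_inner_left ℝ fun h => ?_
  have h0 : (innerSL ℝ h).compLp u = 0 := by
    refine eq_zero_of_inner_cosL fun k => ?_
    have h1 := coeff_compLp (innerSL ℝ h) (cosL k) u
    rw [hu, map_zero] at h1
    rw [← h1, L2.inner_def]
    refine integral_congr_ae (Eventually.of_forall fun t => ?_)
    simp [mul_comm]
  rw [← integral_inner hui.integrableOn h, inner_zero_right]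
  refine integral_eq_zero_of_ae (ae_restrict_of_ae ?_)
  filter_upwards [(innerSL ℝ h).coeFn_compLp u, Lp.eq_zero_iff_ae_eq_zero.1 h0] with t h1 h2
  rw [h2] at h1
  simpa using h1.symm

lemma hasSum_cosL [CompleteSpace H] (u : L2T H) :
    HasSum (fun k => dyad (cosL k) (coeff (cosL k) u)) u := by
  have hs := summable_dyad inner_cosL (summable_norm_coeff_sq inner_cosL u)
  convert hs.hasSum
  rw [← sub_eq_zero]
  refine eq_zero_of_coeff_cosL fun k => ?_
  refine ext_inner_left ℝ fun h => ?_
  rw [← inner_dyad, inner_sub_right, inner_dyad, inner_zero_right, sub_eq_zero]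
  have h1 := hs.hasSum.mapL (innerSL ℝ (dyad (cosL k) h))
  have h2 : HasSum (fun j => (innerSL ℝ (dyad (cosL k) h)) (dyad (cosL j) (coeff (cosL j) u)))
      (inner ℝ h (coeff (cosL k) u)) := by
    convert hasSum_ite_eq k (inner ℝ h (coeff (cosL k) u)) using 2 with j
    simp only [innerSL_apply_apply, inner_dyad_dyad, inner_cosL]
    by_cases hj : j = k
    · subst hj; simp
    · simp [hj, Ne.symm hj]
  exact h2.unique h1

/-- The `k`-th cosine coefficient of `∂_t v` is `√λ_k` times the `k`-th sine coefficient of `v`. -/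
lemma coeff_cosL_deriv [CompleteSpace H] {v : ℝ → H} (hv : ContDiff ℝ 1 v) (hv0 : v 0 = 0)
    {vL gL : L2T H} (h1 : vL =ᵐ[timeMeas] v) (h2 : gL =ᵐ[timeMeas] deriv v) (k : ℕ) :
    coeff (cosL k) gL = √(eigval k) • coeff (sinL k) vL := by
  set a : ℝ := Real.pi / 2 + k * Real.pi with ha
  have hapos : 0 ≤ a := by positivity
  have hsq : √(eigval k) = a := by
    rw [show eigval k = a ^ 2 by rw [eigval, ha]; ring, Real.sqrt_sq hapos]
  have hs : coeff (sinL k) vL = ∫ t in (0 : ℝ)..1, sinMode k t • v t := by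
    rw [coeff, ← integral_timeMeas]
    refine integral_congr_ae ?_
    filter_upwards [h1, coeFn_sinL k] with t e1 e2
    rw [e1, e2]
  have hc : coeff (cosL k) gL = ∫ t in (0 : ℝ)..1, cosMode k t • deriv v t := by
    rw [coeff, ← integral_timeMeas]
    refine integral_congr_ae ?_
    filter_upwards [h2, coeFn_cosL k] with t e1 e2
    rw [e1, e2]
  have hd : ∀ t, HasDerivAt (cosMode k) (-(a * sinMode k t)) t := by
    intro t
    have h := (((hasDerivAt_id t).const_mul a).cos).const_mul (√2)
    exact h.congr_deriv (by simp only [sinMode, id, ha]; ring)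
  have hv1 : ∀ t, HasDerivAt v (deriv v t) t := fun t =>
    (hv.differentiable one_ne_zero t).hasDerivAt
  have hcd : Continuous (deriv v) := hv.continuous_deriv le_rfl
  rw [hc, intervalIntegral.integral_smul_deriv_eq_deriv_smul (fun t _ => hd t) (fun t _ => hv1 t)
    (Continuous.intervalIntegrable (by have := continuous_sinMode k; fun_prop) _ _)
    (hcd.intervalIntegrable _ _), hs, hsq, ← intervalIntegral.integral_smul]
  have hW : cosMode k 1 = 0 := by
    have : Real.cos (Real.pi / 2 + k * Real.pi) = 0 := by
      rw [Real.cos_add_nat_mul_pi]; simp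
    simp [cosMode, this]
  rw [hW, hv0, zero_smul, smul_zero, sub_zero, zero_sub, ← intervalIntegral.integral_neg]
  refine intervalIntegral.integral_congr fun t _ => ?_
  simp [smul_smul]

/-- On differentiable functions vanishing at `t = 0`, `derivPairing` is the `L²(I; H)` inner product
with the classical time derivative. -/
theorem derivPairing_eq_inner [CompleteSpace H] {v : ℝ → H} (hv : ContDiff ℝ 1 v) (hv0 : v 0 = 0)
    {vL gL : L2T H} (h1 : vL =ᵐ[timeMeas] v) (h2 : gL =ᵐ[timeMeas] deriv v) (w : L2T H) :
    derivPairing vL w = inner ℝ gL w := by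
  have h := (hasSum_cosL w).mapL (innerSL ℝ gL)
  rw [derivPairing, ← innerSL_apply_apply, ← h.tsum_eq]
  refine tsum_congr fun k => ?_
  rw [innerSL_apply_apply, real_inner_comm (dyad _ _) gL, inner_dyad, coeff_cosL_deriv hv hv0 h1 h2,
    inner_smul_right, real_inner_comm]

lemma one_le_sqrt_eigval (k : ℕ) : 1 ≤ √(eigval k) := by
  rw [Real.one_le_sqrt, eigval]
  have h1 : (9 : ℝ) ≤ Real.pi ^ 2 := by nlinarith [Real.pi_gt_three]
  have h2 : (1 : ℝ) ≤ (2 * (k : ℝ) + 1) ^ 2 := by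
    nlinarith [(Nat.cast_nonneg k : (0 : ℝ) ≤ k)]
  nlinarith

lemma norm_le_halfNorm_cosL [CompleteSpace H] {w : L2T H} (hw : w ∈ halfSpace cosL H) :
    ‖w‖ ≤ halfNorm cosL w := by
  refine Real.le_sqrt_of_sq_le ?_
  have h := (hasSum_cosL w).mapL (innerSL ℝ w)
  have e : ∀ k, (innerSL ℝ w) (dyad (cosL k) (coeff (cosL k) w)) = ‖coeff (cosL k) w‖ ^ 2 := by
    intro k
    rw [innerSL_apply_apply, real_inner_comm, inner_dyad, real_inner_self_eq_norm_sq]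
  simp only [e, innerSL_apply_apply, real_inner_self_eq_norm_sq] at h
  rw [← h.tsum_eq]
  exact h.summable.tsum_le_tsum (fun k => le_mul_of_one_le_left (by positivity)
    (one_le_sqrt_eigval k)) hw

/-- The set in `dualHalfNorm` is bounded. -/
lemma bddAbove_dualHalfNorm [CompleteSpace H] (g : L2T H) :
    BddAbove {r | ∃ w ∈ halfSpace cosL H, halfNorm cosL w ≤ 1 ∧ r = inner ℝ g w} := by
  refine ⟨‖g‖, ?_⟩
  rintro r ⟨w, hw, h1, rfl⟩
  exact (real_inner_le_norm g w).trans
    (mul_le_of_le_one_right (norm_nonneg g) ((norm_le_halfNorm_cosL hw).trans h1))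

/-- For a bounded operator `P` on `L²(I)` with range in the finite-dimensional space `S` and a linear
map `L : H → K`, the operator `P ⊗ L : L²(I; H) → L²(I; K)`.  With an `L²(I)`-orthonormal basis
`(b_i)` of `S` one has `P z = ∑_i ⟨P* b_i, z⟩ b_i`, hence
`(P ⊗ L) u = ∑_i b_i ⊗ L (∫_I (P* b_i)(t) u(t) dt)`. -/
def tensorOp (S : Submodule ℝ (L2T ℝ)) [FiniteDimensional ℝ S] (P : L2T ℝ →L[ℝ] L2T ℝ)
    (L : H →ₗ[ℝ] K) (u : L2T H) : L2T K :=
  ∑ i, dyad (stdOrthonormalBasis ℝ S i : L2T ℝ)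
    (L (coeff (ContinuousLinearMap.adjoint P (stdOrthonormalBasis ℝ S i : L2T ℝ)) u))

lemma dyad_smul_left (c : ℝ) (φ : L2T ℝ) (h : H) : dyad (c • φ) h = dyad φ (c • h) := by
  apply Lp.ext
  filter_upwards [coeFn_dyad (c • φ) h, coeFn_dyad φ (c • h), Lp.coeFn_smul c φ] with t h1 h2 h3
  rw [h1, h2, h3, Pi.smul_apply, smul_smul, smul_eq_mul, mul_comm]

lemma dyad_sum_left {ι : Type*} (s : Finset ι) (φ : ι → L2T ℝ) (h : H) :
    dyad (∑ i ∈ s, φ i) h = ∑ i ∈ s, dyad (φ i) h :=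
  map_sum ((ContinuousLinearMap.toSpanSingleton ℝ h).compLpL 2 timeMeas) φ s

/-- `(P ⊗ L)(z ⊗ h) = (P z) ⊗ (L h)`. -/
theorem tensorOp_dyad [CompleteSpace H] (S : Submodule ℝ (L2T ℝ)) [FiniteDimensional ℝ S]
    (P : L2T ℝ →L[ℝ] L2T ℝ) (hP : ∀ z, P z ∈ S) (L : H →ₗ[ℝ] K) (z : L2T ℝ) (h : H) :
    tensorOp S P L (dyad z h) = dyad (P z) (L h) := by
  have h1 := (stdOrthonormalBasis ℝ S).sum_repr' ⟨P z, hP z⟩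
  have h2 := congrArg (fun x : S => (x : L2T ℝ)) h1
  simp only [Submodule.coe_sum, Submodule.coe_smul, Submodule.coe_inner] at h2
  rw [tensorOp]
  conv_rhs => rw [← h2, dyad_sum_left]
  refine Finset.sum_congr rfl fun i _ => ?_
  rw [coeff_dyad, map_smul, dyad_smul_left, ContinuousLinearMap.adjoint_inner_left]

/-! ### Temporal trial space -/

/-- `P` is a projection of `L²(I)` onto `S`. -/
def IsTemporalProjection (S : Submodule ℝ (L2T ℝ)) (P : L2T ℝ →L[ℝ] L2T ℝ) : Prop :=
  (∀ z, P z ∈ S) ∧ ∀ z ∈ S, P z = z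

/-- The temporal trial space: continuous functions on `[0, 1]` with value zero at `t = 0` that are
polynomials of degree less than `d` on each of the intervals `[l/N, (l+1)/N]`, `0 ≤ l < N`. -/
def timeSpace (N d : ℕ) : Submodule ℝ (L2T ℝ) where
  carrier := {z | ∃ v : ℝ → ℝ, ContinuousOn v (Icc 0 1) ∧ v 0 = 0 ∧
    (∀ l : Fin N, ∃ p ∈ Polynomial.degreeLT ℝ d,
      ∀ t ∈ Icc ((l : ℝ) / N) ((l + 1 : ℝ) / N), v t = p.eval t) ∧ z =ᵐ[timeMeas] v}
  zero_mem' := ⟨0, continuousOn_const, rfl, fun _ => ⟨0, zero_mem _, by simp⟩, Lp.coeFn_zero _ _ _⟩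
  add_mem' := by
    rintro z₁ z₂ ⟨v₁, c₁, a₁, p₁, e₁⟩ ⟨v₂, c₂, a₂, p₂, e₂⟩
    refine ⟨v₁ + v₂, c₁.add c₂, by simp [a₁, a₂], fun l => ?_, (Lp.coeFn_add _ _).trans (e₁.add e₂)⟩
    obtain ⟨q₁, m₁, h₁⟩ := p₁ l
    obtain ⟨q₂, m₂, h₂⟩ := p₂ l
    exact ⟨q₁ + q₂, add_mem m₁ m₂, fun t ht => by simp [h₁ t ht, h₂ t ht]⟩
  smul_mem' := by
    rintro c z ⟨v, hc, a, p, e⟩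
    refine ⟨c • v, hc.const_smul c, by simp [a], fun l => ?_,
      (Lp.coeFn_smul _ _).trans (e.const_smul c)⟩
    obtain ⟨q, m, h⟩ := p l
    exact ⟨c • q, Submodule.smul_mem _ c m, fun t ht => by simp [h t ht]⟩

lemma memLp_piece (N : ℕ) (l m : ℕ) : MemLp ((Ico ((l : ℝ) / N) ((l + 1 : ℝ) / N)).indicator
    fun t : ℝ => t ^ m) 2 timeMeas :=
  (memLp_timeMeas_of_continuous (by fun_prop)).indicator measurableSet_Ico

instance finiteDimensional_timeSpace (N d : ℕ) [NeZero N] :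
    FiniteDimensional ℝ (timeSpace N d) := by
  let g : Fin N × Fin d → L2T ℝ := fun x => (memLp_piece N x.1 x.2).toLp _
  have hle : timeSpace N d ≤ Submodule.span ℝ (range g) := by
    rintro z ⟨v, -, -, hp, hz⟩
    choose p hpd hp using hp
    have e : z = ∑ x : Fin N × Fin d, (p x.1).coeff x.2 • g x := by
      apply Lp.ext
      have hg : ∀ᵐ t ∂timeMeas, ∀ x : Fin N × Fin d, g x t =
          (Ico ((x.1 : ℝ) / N) ((x.1 + 1 : ℝ) / N)).indicator (fun t : ℝ => t ^ (x.2 : ℕ)) t :=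
        ae_all_iff.2 fun x => (memLp_piece N x.1 x.2).coeFn_toLp
      have hs : ∀ᵐ t ∂timeMeas, (∑ x : Fin N × Fin d, (p x.1).coeff x.2 • g x : L2T ℝ) t
          = ∑ x : Fin N × Fin d, (p x.1).coeff x.2 * g x t := by
        have h1 : ∀ᵐ t ∂timeMeas, ∀ x : Fin N × Fin d,
            ((p x.1).coeff x.2 • g x : L2T ℝ) t = (p x.1).coeff x.2 * g x t := by
          refine ae_all_iff.2 fun x => ?_
          filter_upwards [Lp.coeFn_smul ((p x.1).coeff x.2) (g x)] with t ht
          simp [ht]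
        filter_upwards [Lp.coeFn_fun_finsetSum Finset.univ
          (fun x : Fin N × Fin d => (p x.1).coeff x.2 • g x), h1] with t h2 h3
        rw [h2]
        exact Finset.sum_congr rfl fun x _ => h3 x
      filter_upwards [hz, hg, hs, ae_restrict_mem measurableSet_Ioo] with t h1 h2 h3 h4
      rw [h1, h3, Fintype.sum_prod_type]
      have hN : 0 < N := NeZero.pos N
      have hN' : (0 : ℝ) < N := by exact_mod_cast hN
      set l : ℕ := ⌊t * N⌋₊ with hl
      have hl1 : (l : ℝ) ≤ t * N := Nat.floor_le (by have := h4.1; positivity)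
      have hl2 : t * N < l + 1 := Nat.lt_floor_add_one _
      have hlN : l < N := by
        have : (l : ℝ) < N := by nlinarith [h4.2]
        exact_mod_cast this
      have hmem : ∀ j : Fin N, t ∈ Ico ((j : ℝ) / N) ((j + 1 : ℝ) / N) ↔ j = ⟨l, hlN⟩ := by
        intro j
        rw [mem_Ico, div_le_iff₀ hN', lt_div_iff₀ hN', Fin.ext_iff]
        constructor
        · rintro ⟨a, b⟩
          have := (Nat.floor_eq_iff (by have := h4.1; positivity : 0 ≤ t * N)).2 ⟨a, b⟩
          exact this.symm
        · intro h
          have : (j : ℕ) = l := h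
          rw [this]; exact ⟨hl1, hl2⟩
      rw [Finset.sum_eq_single (⟨l, hlN⟩ : Fin N)]
      · have ht := (hmem ⟨l, hlN⟩).2 rfl
        rw [hp ⟨l, hlN⟩ t ⟨ht.1, ht.2.le⟩]
        have hdeg := Polynomial.mem_degreeLT.1 (hpd ⟨l, hlN⟩)
        rw [Polynomial.eval_eq_sum, ← Polynomial.sum_fin (fun n a => a * t ^ n) (by simp) hdeg]
        refine Finset.sum_congr rfl fun m _ => ?_
        rw [h2, indicator_of_mem ht]
      · intro j _ hj
        refine Finset.sum_eq_zero fun m _ => ?_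
        rw [h2, indicator_of_notMem (fun h => hj ((hmem j).1 h)), mul_zero]
      · simp
    rw [e]
    exact Submodule.sum_mem _ fun x _ => Submodule.smul_mem _ _
      (Submodule.subset_span (mem_range_self x))
  have : FiniteDimensional ℝ (Submodule.span ℝ (range g)) :=
    FiniteDimensional.span_of_finite ℝ (finite_range g)
  exact Submodule.finiteDimensional_of_le hle

end Time

/-! ### The spatial domain -/

section Space

variable {n : ℕ}

/-- The Euclidean space `ℝⁿ`. -/
abbrev Eu (n : ℕ) : Type := EuclideanSpace ℝ (Fin n)

/-- The space `L²(Ω)`. -/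
abbrev L2X (Ω : Set (Eu n)) : Type := Lp ℝ 2 (volume.restrict Ω)

/-- The space `L²(Ω)ⁿ` of vector fields. -/
abbrev L2Xn (Ω : Set (Eu n)) : Type := Lp (Eu n) 2 (volume.restrict Ω)

/-- `H¹_{Γ_D}(Ω)`, the closure in `H¹(Ω)` of the restrictions to `Ω` of all `φ ∈ C_c^∞(ℝⁿ)` with
support disjoint from `Γ_D`.  Elements are pairs `(v, ∇v)` in `L²(Ω) × L²(Ω)ⁿ`, so that the norm
inherited from this Hilbert space is the usual norm of `H¹(Ω)`. -/
def H1D (Ω ΓD : Set (Eu n)) : Submodule ℝ (WithLp 2 (L2X Ω × L2Xn Ω)) :=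
  (Submodule.span ℝ {p | ∃ φ : Eu n → ℝ, ContDiff ℝ (⊤ : ℕ∞) φ ∧ HasCompactSupport φ ∧
    Disjoint (tsupport φ) ΓD ∧ p.fst =ᵐ[volume.restrict Ω] φ ∧
    p.snd =ᵐ[volume.restrict Ω] gradient φ}).topologicalClosure

instance (Ω ΓD : Set (Eu n)) : CompleteSpace (H1D Ω ΓD) :=
  Submodule.topologicalClosure.completeSpace _

/-- The embedding `H¹_{Γ_D}(Ω) → L²(Ω)`. -/
def valX (Ω ΓD : Set (Eu n)) : H1D Ω ΓD →L[ℝ] L2X Ω :=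
  WithLp.fstL 2 ℝ (L2X Ω) (L2Xn Ω) ∘L (H1D Ω ΓD).subtypeL

/-- The gradient `H¹_{Γ_D}(Ω) → L²(Ω)ⁿ`. -/
def gradX (Ω ΓD : Set (Eu n)) : H1D Ω ΓD →L[ℝ] L2Xn Ω :=
  WithLp.sndL 2 ℝ (L2X Ω) (L2Xn Ω) ∘L (H1D Ω ΓD).subtypeL

/-- `gradX v` is the weak gradient of `valX v` in `Ω`. -/
theorem integral_valX_mul_fderiv {Ω ΓD : Set (Eu n)} (v : H1D Ω ΓD)
    (ψ : Eu n → ℝ) (hψ : ContDiff ℝ (⊤ : ℕ∞) ψ) (hc : HasCompactSupport ψ) (hs : tsupport ψ ⊆ Ω)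
    (e : Eu n) :
    ∫ x in Ω, valX Ω ΓD v x * fderiv ℝ ψ x e = - ∫ x in Ω, inner ℝ (gradX Ω ΓD v x) e * ψ x := by
  have hcd : Continuous fun x => fderiv ℝ ψ x e :=
    (hψ.continuous_fderiv (by simp)).clm_apply continuous_const
  have m1 : MemLp (fun x => fderiv ℝ ψ x e) 2 (volume.restrict Ω) :=
    (hcd.memLp_of_hasCompactSupport (hc.fderiv_apply ℝ e)).restrict Ω
  have m2 : MemLp (fun x => ψ x • e) 2 (volume.restrict Ω) :=
    ((hψ.continuous.smul continuous_const).memLp_of_hasCompactSupport hc.smul_right).restrict Ω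
  -- both sides are continuous functionals on `L²(Ω) × L²(Ω)ⁿ`
  let T : WithLp 2 (L2X Ω × L2Xn Ω) →L[ℝ] ℝ :=
    innerSL ℝ (m1.toLp _) ∘L WithLp.fstL 2 ℝ (L2X Ω) (L2Xn Ω)
      + innerSL ℝ (m2.toLp _) ∘L WithLp.sndL 2 ℝ (L2X Ω) (L2Xn Ω)
  have hT : ∀ p : WithLp 2 (L2X Ω × L2Xn Ω), T p = (∫ x in Ω, p.fst x * fderiv ℝ ψ x e)
      + ∫ x in Ω, inner ℝ (p.snd x) e * ψ x := by
    intro p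
    change inner ℝ (m1.toLp _) p.fst + inner ℝ (m2.toLp _) p.snd = _
    rw [L2.inner_def, L2.inner_def]
    congr 1
    · refine integral_congr_ae ?_
      filter_upwards [m1.coeFn_toLp] with x hx
      rw [hx]; simp
    · refine integral_congr_ae ?_
      filter_upwards [m2.coeFn_toLp] with x hx
      rw [hx, inner_smul_left, real_inner_comm]; simp [mul_comm]
  have hker : H1D Ω ΓD ≤ LinearMap.ker T.toLinearMap := by
    refine Submodule.topologicalClosure_minimal _ (Submodule.span_le.2 ?_) T.isClosed_ker
    rintro p ⟨φ, hφ, hφc, -, h1, h2⟩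
    change T p = 0
    have hφd : Differentiable ℝ φ := hφ.differentiable (by simp)
    have hψd : Differentiable ℝ ψ := hψ.differentiable (by simp)
    have hcφ : Continuous fun x => fderiv ℝ φ x e :=
      (hφ.continuous_fderiv (by simp)).clm_apply continuous_const
    have key := integral_mul_fderiv_eq_neg_fderiv_mul_of_integrable (μ := (volume : Measure (Eu n)))
      (f := φ) (g := ψ) (v := e)
      ((hcφ.mul hψ.continuous).integrable_of_hasCompactSupport hc.mul_left)
      ((hφ.continuous.mul hcd).integrable_of_hasCompactSupport hφc.mul_right)
      ((hφ.continuous.mul hψ.continuous).integrable_of_hasCompactSupport hc.mul_left)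
      (fun x _ => hφd x) (fun x _ => hψd x)
    have z1 : ∀ x, x ∉ Ω → ψ x = 0 := fun x hx => image_eq_zero_of_notMem_tsupport fun h => hx (hs h)
    have z2 : ∀ x, x ∉ Ω → fderiv ℝ ψ x e = 0 := fun x hx => by
      rw [image_eq_zero_of_notMem_tsupport fun h => hx (hs (tsupport_fderiv_subset ℝ h))]; rfl
    rw [hT]
    have i1 : ∫ x in Ω, p.fst x * fderiv ℝ ψ x e = ∫ x, φ x * fderiv ℝ ψ x e := by
      refine Eq.trans ?_ (setIntegral_eq_integral_of_forall_compl_eq_zero (s := Ω) fun x hx => by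
        rw [z2 x hx, mul_zero])
      refine integral_congr_ae ?_
      filter_upwards [h1] with x hx
      rw [hx]
    have i2 : ∫ x in Ω, inner ℝ (p.snd x) e * ψ x = ∫ x, fderiv ℝ φ x e * ψ x := by
      refine Eq.trans ?_ (setIntegral_eq_integral_of_forall_compl_eq_zero (s := Ω) fun x hx => by
        rw [z1 x hx, mul_zero])
      refine integral_congr_ae ?_
      filter_upwards [h2] with x hx
      rw [hx, gradient, InnerProductSpace.toDual_symm_apply]
    rw [i1, i2, key, neg_add_cancel]
  have h := hker v.2
  have h' : T v = 0 := h
  rw [hT] at h'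
  exact eq_neg_of_add_eq_zero_left h'

/-- Coefficients `A ∈ L^∞(Ω; ℝ^{n×n}_sym)` that are uniformly positive definite. -/
structure IsDiffusionCoefficient (Ω : Set (Eu n)) (A : Eu n → Matrix (Fin n) (Fin n) ℝ) : Prop where
  measurable : ∀ i j, AEStronglyMeasurable (fun x => A x i j) (volume.restrict Ω)
  bounded : ∃ M : ℝ, ∀ᵐ x ∂volume.restrict Ω, ∀ i j, |A x i j| ≤ M
  symm : ∀ᵐ x ∂volume.restrict Ω, (A x).IsSymm
  elliptic : ∃ α : ℝ, 0 < α ∧ ∀ᵐ x ∂volume.restrict Ω, ∀ ξ : Fin n → ℝ,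
    α * (ξ ⬝ᵥ ξ) ≤ ξ ⬝ᵥ (A x).mulVec ξ

/-- The spatial bilinear form `⟨A ∇v, ∇w⟩_{L²(Ω)ⁿ}`. -/
def formX (Ω ΓD : Set (Eu n)) (A : Eu n → Matrix (Fin n) (Fin n) ℝ) (v w : H1D Ω ΓD) : ℝ :=
  ∫ x in Ω, (A x).mulVec (gradX Ω ΓD v x).ofLp ⬝ᵥ (gradX Ω ΓD w x).ofLp

/-- A decomposition of `Ω` into finitely many disjoint open elements. -/
structure SpatialMesh (Ω : Set (Eu n)) where
  /-- the number of elements -/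
  card : ℕ
  /-- the elements -/
  elem : Fin card → Set (Eu n)
  isOpen : ∀ i, IsOpen (elem i)
  subset : ∀ i, elem i ⊆ Ω
  disjoint : Pairwise fun i j => Disjoint (elem i) (elem j)
  cover : closure Ω ⊆ ⋃ i, closure (elem i)

/-- The spatial finite element space: functions in `H¹_{Γ_D}(Ω)` that are continuous on the closure
of `Ω`, vanish on `Γ_D` and coincide with a polynomial of total degree at most `p` on the closure of
each element of the mesh. -/
def femSpace {Ω : Set (Eu n)} (ΓD : Set (Eu n)) (T : SpatialMesh Ω) (p : ℕ) :
    Submodule ℝ (H1D Ω ΓD) where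
  carrier := {w | ∃ f : Eu n → ℝ, ContinuousOn f (closure Ω) ∧ (∀ x ∈ ΓD, f x = 0) ∧
    (∀ i, ∃ q : MvPolynomial (Fin n) ℝ, q.totalDegree ≤ p ∧
      ∀ x ∈ closure (T.elem i), f x = MvPolynomial.eval (fun k => x k) q) ∧
    valX Ω ΓD w =ᵐ[volume.restrict Ω] f}
  zero_mem' := ⟨0, continuousOn_const, fun _ _ => rfl, fun _ => ⟨0, by simp, by simp⟩, by
    rw [map_zero]; exact Lp.coeFn_zero _ _ _⟩
  add_mem' := by
    rintro w₁ w₂ ⟨f₁, c₁, a₁, p₁, e₁⟩ ⟨f₂, c₂, a₂, p₂, e₂⟩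
    refine ⟨f₁ + f₂, c₁.add c₂, fun x hx => by simp [a₁ x hx, a₂ x hx], fun i => ?_, ?_⟩
    · obtain ⟨q₁, m₁, h₁⟩ := p₁ i
      obtain ⟨q₂, m₂, h₂⟩ := p₂ i
      exact ⟨q₁ + q₂, (MvPolynomial.totalDegree_add _ _).trans (max_le m₁ m₂),
        fun x hx => by simp [h₁ x hx, h₂ x hx]⟩
    · rw [map_add]; exact (Lp.coeFn_add _ _).trans (e₁.add e₂)
  smul_mem' := by
    rintro c w ⟨f, hc, a, p, e⟩
    refine ⟨c • f, hc.const_smul c, fun x hx => by simp [a x hx], fun i => ?_, ?_⟩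
    · obtain ⟨q, m, h⟩ := p i
      exact ⟨c • q, (MvPolynomial.totalDegree_smul_le _ _).trans m, fun x hx => by simp [h x hx]⟩
    · rw [map_smul]; exact (Lp.coeFn_smul _ _).trans (e.const_smul c)

end Space

/-! ### The space-time problem -/

section SpaceTime

variable {n : ℕ} {Ω ΓD : Set (Eu n)}

/-- `u ∈ L²(I; H¹_{Γ_D}(Ω))` regarded as an element of `L²(I; L²(Ω)) = L²(Q)`. -/
def valQ (u : L2T (H1D Ω ΓD)) : L2T (L2X Ω) := (valX Ω ΓD).compLp u

/-- `⟨A ∇_x u, ∇_x w⟩_{L²(Q)ⁿ}`. -/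
def formQ (A : Eu n → Matrix (Fin n) (Fin n) ℝ) (u w : L2T (H1D Ω ΓD)) : ℝ :=
  ∫ t, formX Ω ΓD A (u t) (w t) ∂timeMeas

/-- `H^{1,1/2}_{Γ_D;0,}(Q) = L²(I; H¹_{Γ_D}(Ω)) ∩ H^{1/2}_{0,}(I; L²(Ω))`. -/
def trialQ (Ω ΓD : Set (Eu n)) : Submodule ℝ (L2T (H1D Ω ΓD)) :=
  (halfSpace sinL (L2X Ω)).comap ((valX Ω ΓD).compLpₗ 2 timeMeas)

/-- `H^{1,1/2}_{Γ_D;,0}(Q) = L²(I; H¹_{Γ_D}(Ω)) ∩ H^{1/2}_{,0}(I; L²(Ω))`. -/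
def testQ (Ω ΓD : Set (Eu n)) : Submodule ℝ (L2T (H1D Ω ΓD)) :=
  (halfSpace cosL (L2X Ω)).comap ((valX Ω ΓD).compLpₗ 2 timeMeas)

/-- `H_T` maps `H^{1,1/2}_{Γ_D;0,}(Q)` into `H^{1,1/2}_{Γ_D;,0}(Q)`. -/
lemma hilbertT_mem_testQ {v : L2T (H1D Ω ΓD)} (hv : v ∈ trialQ Ω ΓD) :
    hilbertT v ∈ testQ Ω ΓD := by
  change Summable fun k => √(eigval k) * ‖coeff (cosL k) ((valX Ω ΓD).compLp (hilbertT v))‖ ^ 2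
  have hv' : Summable fun k => √(eigval k) * ‖coeff (sinL k) ((valX Ω ΓD).compLp v)‖ ^ 2 := hv
  refine hv'.congr fun k => ?_
  rw [coeff_compLp, coeff_compLp, coeff_cosL_hilbertT]

/-- The bilinear form `b(u, w) = ⟨∂_t u, w⟩_Q + ⟨A ∇_x u, ∇_x w⟩_{L²(Q)ⁿ}`. -/
def formB (A : Eu n → Matrix (Fin n) (Fin n) ℝ) (u w : L2T (H1D Ω ΓD)) : ℝ :=
  derivPairing (valQ u) (valQ w) + formQ A u w

/-- Continuity of a linear functional on `H^{1,1/2}_{Γ_D;,0}(Q)` for the sum norm. -/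
def IsBoundedFunctional (f : testQ Ω ΓD →ₗ[ℝ] ℝ) : Prop :=
  ∃ C : ℝ, ∀ w : testQ Ω ΓD, |f w| ≤
    C * (‖(gradX Ω ΓD).compLp w.1‖ + halfNorm cosL (valQ w.1))

/-- `u` solves the space-time variational problem with right-hand side `f`. -/
def IsVariationalSolution (A : Eu n → Matrix (Fin n) (Fin n) ℝ) (f : testQ Ω ΓD →ₗ[ℝ] ℝ)
    (u : L2T (H1D Ω ΓD)) : Prop :=
  u ∈ trialQ Ω ΓD ∧ ∀ w : testQ Ω ΓD, formB A u w.1 = f w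

/-- `ℒ_x u ∈ L²(Q)` and `ℒ_x u = g`, for `ℒ_x u` the functional `w ↦ ⟨A ∇_x u, ∇_x w⟩_{L²(Q)ⁿ}` on
`H^{1,1/2}_{Γ_D;,0}(Q)`. -/
def IsSpatialOperator (A : Eu n → Matrix (Fin n) (Fin n) ℝ) (u : L2T (H1D Ω ΓD))
    (g : L2T (L2X Ω)) : Prop :=
  ∀ w ∈ testQ Ω ΓD, formQ A u w = inner ℝ g (valQ w)

/-- The tensor-product trial space `S^x ⊗ S^t`. -/
def trialSpace (Sx : Submodule ℝ (H1D Ω ΓD)) (St : Submodule ℝ (L2T ℝ)) :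
    Submodule ℝ (L2T (H1D Ω ΓD)) :=
  Submodule.span ℝ {z | ∃ ψ ∈ Sx, ∃ φ ∈ St, z = dyad φ ψ}

/-- `uj ∈ S` is the Galerkin approximation: `b(uj, H_T v) = ⟨f, H_T v⟩_Q` for all `v ∈ S`. -/
def IsGalerkinSolution (A : Eu n → Matrix (Fin n) (Fin n) ℝ) (f : testQ Ω ΓD →ₗ[ℝ] ℝ)
    (S : Submodule ℝ (L2T (H1D Ω ΓD))) (uj : L2T (H1D Ω ΓD)) : Prop :=
  uj ∈ S ∧ ∀ v ∈ S, ∀ hv : v ∈ trialQ Ω ΓD,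
    formB A uj (hilbertT v) = f ⟨hilbertT v, hilbertT_mem_testQ hv⟩

/-- `P` is the Ritz projection of `H¹_{Γ_D}(Ω)` onto `Sx`. -/
def IsRitzProjection (A : Eu n → Matrix (Fin n) (Fin n) ℝ) (Sx : Submodule ℝ (H1D Ω ΓD))
    (P : H1D Ω ΓD →ₗ[ℝ] H1D Ω ΓD) : Prop :=
  ∀ z, P z ∈ Sx ∧ ∀ w ∈ Sx, formX Ω ΓD A (P z) w = formX Ω ΓD A z w

end SpaceTime

end SpaceTimeHeat

end

open SpaceTimeHeat

/-! Write `Pu` for the projected solution `tensorOp St Pt Px u` and put `v = uj - Pu`, which lies in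
the trial space. The natural test function is `hilbertT v`. Its cosine coefficients are the sine
coefficients of `v`, so the time-derivative part of `b(v, H_T v)` is exactly the squared half-order
norm of `v` (`derivPairing_hilbertT`).

The elliptic part is nonnegative (`formQ_hilbertT_nonneg`). Expanding in modes produces the matrix
`⟨V_j, W_k⟩`, whose symmetrization is `2/π` times the Hankel matrix of the moments `∫ x^(j+k)` over
`[-1, 1]`. It is therefore positive semidefinite, and it stays so when combined with a symmetric
nonnegative operator in space.

Galerkin orthogonality then bounds `‖v‖²` by `b(u - Pu, H_T v)`. Cauchy–Schwarz on the weighted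
coefficient sequences bounds the time part by `‖u - Pu‖ ‖v‖`. In the elliptic part, `H_T` acts on
the time factor only, so the test function still has its spatial factors in `Sx` and the Ritz
projection drops out. What remains is the pairing of `(Id - P^t ⊗ Id) ℒ_x u` with `H_T v`
(`formQ_sub_tensorOp`), bounded by the dual norm times `‖v‖`. Dividing by `‖v‖` and adding `‖u -
Pu‖` by the triangle inequality produces the factor 2.

The inclusion of the trial space in `trialQ` holds because continuous piecewise polynomials
vanishing at `0` have a square-integrable derivative. -/

namespace SpaceTimeHeat

section Time

variable {H : Type*} [NormedAddCommGroup H] [InnerProductSpace ℝ H]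

/-! ### Completeness of the sine system -/

lemma sqrt_eigval (k : ℕ) : √(eigval k) = Real.pi / 2 + k * Real.pi := by
  rw [show eigval k = (Real.pi / 2 + k * Real.pi) ^ 2 by rw [eigval]; ring,
    Real.sqrt_sq (by positivity)]

lemma measurePreserving_one_sub : MeasurePreserving (fun t : ℝ => 1 - t) timeMeas timeMeas := by
  have h := (Measure.measurePreserving_sub_left (volume : Measure ℝ) 1).restrict_preimage
    (measurableSet_Ioo (a := (0 : ℝ)) (b := 1))
  simpa using h

/-- At `t = 1` the frequency `π/2 + kπ` has cosine `0` and sine `(-1)^k`. Time reversal thus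
exchanges the two systems up to sign, and totality of the sines follows from that of the cosines. -/
lemma cosMode_one_sub (k : ℕ) (t : ℝ) : cosMode k (1 - t) = (-1) ^ k * sinMode k t := by
  have h1 : Real.cos (Real.pi / 2 + k * Real.pi) = 0 := by rw [Real.cos_add_nat_mul_pi]; simp
  have h2 : Real.sin (Real.pi / 2 + k * Real.pi) = (-1) ^ k := by
    rw [Real.sin_add_nat_mul_pi]; simp
  simp only [cosMode, sinMode, mul_sub, mul_one, Real.cos_sub, h1, h2]
  ring

lemma coeff_cosL_compMeasurePreserving (k : ℕ) (u : L2T H) :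
    coeff (cosL k) (Lp.compMeasurePreserving _ measurePreserving_one_sub u)
      = (-1 : ℝ) ^ k • coeff (sinL k) u := by
  have hemb : MeasurableEmbedding (fun t : ℝ => 1 - t) :=
    (MeasurableEquiv.subLeft (1 : ℝ)).measurableEmbedding
  rw [coeff, coeff, ← integral_smul]
  -- The sine integral is reflected, so that both integrands can be compared pointwise at the same
  -- `t`.
  rw [← measurePreserving_one_sub.integral_comp hemb (fun t => (-1 : ℝ) ^ k • sinL k t • u t)]
  refine integral_congr_ae ?_
  filter_upwards [coeFn_cosL k, measurePreserving_one_sub.quasiMeasurePreserving.ae (coeFn_sinL k),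
    Lp.coeFn_compMeasurePreserving u measurePreserving_one_sub] with t h1 h2 h3
  have h4 := cosMode_one_sub k (1 - t)
  rw [sub_sub_cancel] at h4
  rw [h1, h2, h3, h4, smul_smul, Function.comp]

lemma eq_zero_of_coeff_sinL [CompleteSpace H] {u : L2T H} (hu : ∀ k, coeff (sinL k) u = 0) :
    u = 0 := by
  have h : Lp.compMeasurePreserving _ measurePreserving_one_sub u = 0 :=
    eq_zero_of_coeff_cosL fun k => by rw [coeff_cosL_compMeasurePreserving, hu, smul_zero]
  -- Reflection is an isometry of `L²(I; H)`, so a function with zero reflection is zero.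
  rw [← norm_eq_zero, ← Lp.norm_compMeasurePreserving u measurePreserving_one_sub, h, norm_zero]

lemma hasSum_sinL [CompleteSpace H] (u : L2T H) :
    HasSum (fun k => dyad (sinL k) (coeff (sinL k) u)) u := by
  have hs := summable_dyad inner_sinL (summable_norm_coeff_sq inner_sinL u)
  convert hs.hasSum
  rw [← sub_eq_zero]
  refine eq_zero_of_coeff_sinL fun k => ext_inner_left ℝ fun h => ?_
  rw [← inner_dyad, inner_sub_right, inner_dyad, inner_zero_right, sub_eq_zero]
  have h1 := hs.hasSum.mapL (innerSL ℝ (dyad (sinL k) h))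
  have h2 : HasSum (fun j => (innerSL ℝ (dyad (sinL k) h)) (dyad (sinL j) (coeff (sinL j) u)))
      (inner ℝ h (coeff (sinL k) u)) := by
    convert hasSum_ite_eq k (inner ℝ h (coeff (sinL k) u)) using 2 with j
    simp only [innerSL_apply_apply, inner_dyad_dyad, inner_sinL]
    by_cases hj : j = k
    · subst hj; simp
    · simp [hj, Ne.symm hj]
  exact h2.unique h1

/-! ### Positivity of the modified Hilbert transform -/

/-- Both sides equal `(1 - (-1)^(m+1)) / ((m+1)π)`. Writing the sine integral as a moment is what
exposes the Hankel structure. -/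
lemma integral_sin_mul_pi (m : ℕ) :
    ∫ t in (0 : ℝ)..1, Real.sin ((m + 1) * Real.pi * t)
      = 1 / Real.pi * ∫ x in (-1 : ℝ)..1, x ^ m := by
  have h : ((m + 1) * Real.pi : ℝ) ≠ 0 := by positivity
  rw [intervalIntegral.integral_comp_mul_left (fun x => Real.sin x) h, integral_sin, integral_pow]
  have h1 : Real.cos ((m + 1) * Real.pi * 1) = (-1) ^ (m + 1) := by
    have := Real.cos_nat_mul_pi (m + 1)
    push_cast at this
    rw [mul_one, this]
  rw [h1, mul_zero, Real.cos_zero, one_pow, smul_eq_mul]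
  field_simp

/-- By the addition formula, `V_j W_k + V_k W_j = 2 sin((j + k + 1)πt)`, which depends on `j + k`
only; the 2 comes from the normalization `√2` of the modes. -/
lemma inner_sinL_cosL_add (j k : ℕ) :
    inner ℝ (sinL j) (cosL k) + inner ℝ (sinL k) (cosL j)
      = 2 / Real.pi * ∫ x in (-1 : ℝ)..1, x ^ (j + k) := by
  have h : ∀ j k, inner ℝ (sinL j) (cosL k) = ∫ t in (0 : ℝ)..1, sinMode j t * cosMode k t := by
    intro j k
    rw [L2.inner_def, ← integral_timeMeas]
    refine integral_congr_ae ?_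
    filter_upwards [coeFn_sinL j, coeFn_cosL k] with t h1 h2
    rw [h1, h2]
    simp [mul_comm]
  have hi : ∀ j k, IntervalIntegrable (fun t => sinMode j t * cosMode k t) volume 0 1 :=
    fun j k => ((continuous_sinMode j).mul (continuous_cosMode k)).intervalIntegrable _ _
  rw [h, h, ← intervalIntegral.integral_add (hi _ _) (hi _ _), div_eq_mul_one_div, mul_assoc,
    ← integral_sin_mul_pi, ← intervalIntegral.integral_const_mul]
  refine intervalIntegral.integral_congr fun t _ => ?_
  have h3 := Real.mul_self_sqrt (show (0 : ℝ) ≤ 2 by norm_num)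
  have e : (((j + k : ℕ) : ℝ) + 1) * Real.pi * t
      = (Real.pi / 2 + j * Real.pi) * t + (Real.pi / 2 + k * Real.pi) * t := by push_cast; ring
  simp only [sinMode, cosMode, e, Real.sin_add]
  linear_combination (Real.sin ((Real.pi / 2 + j * Real.pi) * t)
      * Real.cos ((Real.pi / 2 + k * Real.pi) * t) + Real.sin ((Real.pi / 2 + k * Real.pi) * t)
      * Real.cos ((Real.pi / 2 + j * Real.pi) * t)) * h3

/-- Symmetry of `T` allows `⟨V_j, W_k⟩` to be replaced by its symmetrization. The double sum then
becomes `1/π` times the integral over `[-1, 1]` of `⟨T q(x), q(x)⟩`, where `q(x) = ∑ x^j c_j`. -/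
lemma sum_inner_sinL_cosL_nonneg {T : H →L[ℝ] H}
    (hsymm : ∀ v w, inner ℝ (T v) w = inner ℝ (T w) v) (hpos : ∀ v, 0 ≤ inner ℝ (T v) v)
    (s : Finset ℕ) (c : ℕ → H) :
    0 ≤ ∑ j ∈ s, ∑ k ∈ s, inner ℝ (sinL j) (cosL k) * inner ℝ (T (c j)) (c k) := by
  set X := ∑ j ∈ s, ∑ k ∈ s, inner ℝ (sinL j) (cosL k) * inner ℝ (T (c j)) (c k) with hX
  have h1 : X = ∑ j ∈ s, ∑ k ∈ s, inner ℝ (sinL k) (cosL j) * inner ℝ (T (c j)) (c k) := by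
    rw [hX, Finset.sum_comm]
    refine Finset.sum_congr rfl fun j _ => Finset.sum_congr rfl fun k _ => ?_
    rw [hsymm]
  have h2 : X + X = 2 / Real.pi * ∫ x in (-1 : ℝ)..1,
      inner ℝ (T (∑ j ∈ s, x ^ j • c j)) (∑ k ∈ s, x ^ k • c k) := by
    -- Only one of the two copies of `X` is transposed, so their sum carries the symmetrized matrix.
    nth_rewrite 2 [h1]
    have e : ∀ x : ℝ, inner ℝ (T (∑ j ∈ s, x ^ j • c j)) (∑ k ∈ s, x ^ k • c k)
        = ∑ j ∈ s, ∑ k ∈ s, x ^ (j + k) * inner ℝ (T (c j)) (c k) := by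
      intro x
      simp only [map_sum, map_smul, sum_inner, inner_sum, inner_smul_left, inner_smul_right]
      rw [Finset.sum_comm]
      refine Finset.sum_congr rfl fun j _ => ?_
      rw [Finset.mul_sum]
      refine Finset.sum_congr rfl fun k _ => ?_
      rw [conj_trivial]
      ring
    simp_rw [e]
    rw [intervalIntegral.integral_finsetSum fun j _ =>
      Continuous.intervalIntegrable (by fun_prop) _ _, hX, ← Finset.sum_add_distrib, Finset.mul_sum]
    refine Finset.sum_congr rfl fun j _ => ?_
    rw [intervalIntegral.integral_finsetSum fun k _ =>
      Continuous.intervalIntegrable (by fun_prop) _ _, ← Finset.sum_add_distrib, Finset.mul_sum]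
    refine Finset.sum_congr rfl fun k _ => ?_
    rw [intervalIntegral.integral_mul_const, ← add_mul, inner_sinL_cosL_add, mul_assoc]
  have h3 : 0 ≤ X + X := by
    rw [h2]
    exact mul_nonneg (by positivity)
      (intervalIntegral.integral_nonneg (by norm_num) fun x _ => hpos _)
  linarith

/-- Truncating the sine expansion of `v` and the cosine expansion of `hilbertT v` to the same modes
leaves the same coefficients in both, so the finite inequality applies and passes to the limit. -/
lemma inner_compLp_hilbertT_nonneg [CompleteSpace H] {T : H →L[ℝ] H}
    (hsymm : ∀ v w, inner ℝ (T v) w = inner ℝ (T w) v) (hpos : ∀ v, 0 ≤ inner ℝ (T v) v)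
    (v : L2T H) : 0 ≤ inner ℝ (T.compLp v) (hilbertT v) := by
  have h1 : Tendsto (fun s : Finset ℕ => ∑ k ∈ s, dyad (sinL k) (T (coeff (sinL k) v))) atTop
      (nhds (T.compLp v)) := by
    have h := (hasSum_sinL v).mapL (T.compLpL 2 timeMeas)
    have e : ∀ k, T.compLpL 2 timeMeas (dyad (sinL k) (coeff (sinL k) v))
        = dyad (sinL k) (T (coeff (sinL k) v)) := fun k => compLp_dyad T _ _
    simp only [e] at h
    exact h
  have h2 : Tendsto (fun s : Finset ℕ => ∑ k ∈ s, dyad (cosL k) (coeff (sinL k) v)) atTop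
      (nhds (hilbertT v)) := hasSum_hilbertT v
  refine ge_of_tendsto' (h1.inner h2) fun s => ?_
  simp only [sum_inner, inner_sum, inner_dyad_dyad]
  rw [Finset.sum_comm]
  exact sum_inner_sinL_cosL_nonneg hsymm hpos s _

end Time

section HalfNorm

variable {H : Type*} [NormedAddCommGroup H] [InnerProductSpace ℝ H]

/-! ### The half-order norms as norms of square-summable sequences -/

lemma coeff_sub (φ : L2T ℝ) (u v : L2T H) : coeff φ (u - v) = coeff φ u - coeff φ v := by
  rw [sub_eq_add_neg, coeff_add, ← neg_one_smul ℝ v, coeff_smul, neg_one_smul, ← sub_eq_add_neg]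

lemma coeff_zero (φ : L2T ℝ) : coeff φ (0 : L2T H) = 0 := by
  simpa using coeff_smul φ 0 (0 : L2T H)

lemma coeff_eq_inner (φ ψ : L2T ℝ) : coeff φ ψ = inner ℝ φ ψ := by
  rw [coeff, L2.inner_def]
  exact integral_congr_ae (Eventually.of_forall fun t => by simp [mul_comm])

lemma norm_sqrt_smul_sq (a : ℝ) (h : H) : ‖√(√a) • h‖ ^ 2 = √a * ‖h‖ ^ 2 := by
  rw [norm_smul, mul_pow, Real.norm_of_nonneg (Real.sqrt_nonneg _),
    Real.sq_sqrt (Real.sqrt_nonneg _)]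

/-- The weighted coefficient sequence `λ_k^{1/4} u_k` of `u ∈ halfSpace e H`. -/
noncomputable def halfSeq (e : ℕ → L2T ℝ) (u : halfSpace e H) : lp (fun _ : ℕ => H) 2 :=
  ⟨fun k => √(√(eigval k)) • coeff (e k) u.1, memℓp_gen (by
    simpa [norm_sqrt_smul_sq] using (show Summable fun k => √(eigval k) * ‖coeff (e k) u.1‖ ^ 2
      from u.2))⟩

lemma halfSeq_apply (e : ℕ → L2T ℝ) (u : halfSpace e H) (k : ℕ) :
    halfSeq e u k = √(√(eigval k)) • coeff (e k) u.1 := rfl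

lemma halfSeq_add (e : ℕ → L2T ℝ) (u v : halfSpace e H) :
    halfSeq e (u + v) = halfSeq e u + halfSeq e v := by
  refine lp.ext (funext fun k => ?_)
  rw [lp.coeFn_add, Pi.add_apply]
  simp only [halfSeq_apply, Submodule.coe_add, coeff_add, smul_add]

lemma halfSeq_sub (e : ℕ → L2T ℝ) (u v : halfSpace e H) :
    halfSeq e (u - v) = halfSeq e u - halfSeq e v := by
  rw [eq_sub_iff_add_eq, ← halfSeq_add, sub_add_cancel]

/-- The two systems may differ: equal systems give the squared half-order norm, while sines against
cosines give `derivPairing`. The triangle and Cauchy–Schwarz inequalities are thereby inherited from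
`ℓ²`. -/
lemma inner_halfSeq (e e' : ℕ → L2T ℝ) (u : halfSpace e H) (v : halfSpace e' H) :
    inner ℝ (halfSeq e u) (halfSeq e' v)
      = ∑' k, √(eigval k) * inner ℝ (coeff (e k) u.1) (coeff (e' k) v.1) := by
  rw [lp.inner_eq_tsum]
  refine tsum_congr fun k => ?_
  rw [halfSeq_apply, halfSeq_apply, inner_smul_left, inner_smul_right, ← mul_assoc, conj_trivial,
    Real.mul_self_sqrt (Real.sqrt_nonneg _)]

lemma norm_halfSeq (e : ℕ → L2T ℝ) (u : halfSpace e H) : ‖halfSeq e u‖ = halfNorm e u.1 := by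
  rw [halfNorm, eq_comm, Real.sqrt_eq_iff_mul_self_eq
    (tsum_nonneg fun k => by positivity) (norm_nonneg _), ← real_inner_self_eq_norm_mul_norm,
    inner_halfSeq]
  simp only [real_inner_self_eq_norm_sq]

lemma derivPairing_eq_inner_halfSeq (u : halfSpace sinL H) (w : halfSpace cosL H) :
    derivPairing u.1 w.1 = inner ℝ (halfSeq sinL u) (halfSeq cosL w) :=
  (inner_halfSeq sinL cosL u w).symm

lemma halfNorm_nonneg (e : ℕ → L2T ℝ) (u : L2T H) : 0 ≤ halfNorm e u := Real.sqrt_nonneg _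

lemma halfNorm_add_le {e : ℕ → L2T ℝ} {u v : L2T H} (hu : u ∈ halfSpace e H)
    (hv : v ∈ halfSpace e H) : halfNorm e (u + v) ≤ halfNorm e u + halfNorm e v := by
  have h := norm_add_le (halfSeq e ⟨u, hu⟩) (halfSeq e ⟨v, hv⟩)
  rwa [← halfSeq_add, norm_halfSeq, norm_halfSeq, norm_halfSeq] at h

lemma halfNorm_sub_comm {e : ℕ → L2T ℝ} (u v : L2T H) :
    halfNorm e (u - v) = halfNorm e (v - u) := by
  simp only [halfNorm, coeff_sub, norm_sub_rev]

lemma halfNorm_smul (e : ℕ → L2T ℝ) (c : ℝ) (u : L2T H) :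
    halfNorm e (c • u) = |c| * halfNorm e u := by
  rw [halfNorm, halfNorm, ← Real.sqrt_sq (abs_nonneg c), ← Real.sqrt_mul (sq_nonneg _),
    ← tsum_mul_left]
  congr 1
  refine tsum_congr fun k => ?_
  rw [coeff_smul, norm_smul, mul_pow, Real.norm_eq_abs]
  ring

lemma derivPairing_le {v w : L2T H} (hv : v ∈ halfSpace sinL H) (hw : w ∈ halfSpace cosL H) :
    derivPairing v w ≤ halfNorm sinL v * halfNorm cosL w := by
  have h := real_inner_le_norm (halfSeq sinL ⟨v, hv⟩) (halfSeq cosL ⟨w, hw⟩)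
  rwa [← derivPairing_eq_inner_halfSeq, norm_halfSeq, norm_halfSeq] at h

lemma derivPairing_sub_left {u v w : L2T H} (hu : u ∈ halfSpace sinL H)
    (hv : v ∈ halfSpace sinL H) (hw : w ∈ halfSpace cosL H) :
    derivPairing (u - v) w = derivPairing u w - derivPairing v w := by
  have h := inner_sub_left (𝕜 := ℝ) (halfSeq sinL ⟨u, hu⟩) (halfSeq sinL ⟨v, hv⟩)
    (halfSeq cosL ⟨w, hw⟩)
  rwa [← halfSeq_sub, ← derivPairing_eq_inner_halfSeq, ← derivPairing_eq_inner_halfSeq,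
    ← derivPairing_eq_inner_halfSeq] at h

/-- `⟨g, w⟩` is bounded by the dual norm of `g` times the norm of `w`. -/
lemma inner_le_dualHalfNorm_mul [CompleteSpace H] (g : L2T H) {w : L2T H}
    (hw : w ∈ halfSpace cosL H) : inner ℝ g w ≤ dualHalfNorm g * halfNorm cosL w := by
  rcases (halfNorm_nonneg cosL w).eq_or_lt with h0 | hpos
  -- The half-order norm dominates the `L²` norm, so it vanishes only at `w = 0`; every other `w`
  -- can be normalized.
  · have : w = 0 := by
      rw [← norm_le_zero_iff]
      exact (norm_le_halfNorm_cosL hw).trans h0.ge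
    rw [← h0, this, inner_zero_right, mul_zero]
  · rw [← div_le_iff₀ hpos]
    refine le_csSup (bddAbove_dualHalfNorm g)
      ⟨(halfNorm cosL w)⁻¹ • w, Submodule.smul_mem _ _ hw, ?_, ?_⟩
    · rw [halfNorm_smul, abs_of_pos (inv_pos.2 hpos), inv_mul_cancel₀ hpos.ne']
    · rw [inner_smul_right, div_eq_inv_mul]

/-! ### The temporal trial functions belong to `H^{1/2}_{0,}(I)` -/

/-- Bessel's inequality for `z'`, which plays the role of `∂_t z`, gives `∑ λ_k |z_k|² < ∞`. This is
more than required, since `√λ_k ≥ 1` implies `√λ_k ≤ λ_k`. -/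
lemma mem_halfSpace_sinL_of_coeff {z z' : L2T ℝ}
    (h : ∀ k, coeff (cosL k) z' = √(eigval k) * coeff (sinL k) z) : z ∈ halfSpace sinL ℝ := by
  refine Summable.of_nonneg_of_le (fun k => by positivity) (fun k => ?_)
    (summable_norm_coeff_sq inner_cosL z')
  rw [h, norm_mul, mul_pow, Real.norm_of_nonneg (Real.sqrt_nonneg _)]
  refine mul_le_mul_of_nonneg_right ?_ (by positivity)
  nlinarith [one_le_sqrt_eigval k]

/-- Integration by parts against `W_k`: the boundary terms vanish because `v 0 = 0` and `W_k(1) =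
0`. A right derivative suffices, so kinks at the time nodes are harmless. -/
lemma mem_halfSpace_sinL_of_hasDerivWithinAt {v v' : ℝ → ℝ} {z : L2T ℝ} (hz : z =ᵐ[timeMeas] v)
    (hv : ContinuousOn v (Icc 0 1)) (hv0 : v 0 = 0) (hv' : MemLp v' 2 timeMeas)
    (hd : ∀ t ∈ Ioo (0 : ℝ) 1, HasDerivWithinAt v (v' t) (Ioi t) t) : z ∈ halfSpace sinL ℝ := by
  refine mem_halfSpace_sinL_of_coeff (z' := hv'.toLp v') fun k => ?_
  have hs : coeff (sinL k) z = ∫ t in (0 : ℝ)..1, sinMode k t * v t := by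
    rw [coeff, ← integral_timeMeas]
    refine integral_congr_ae ?_
    filter_upwards [hz, coeFn_sinL k] with t e1 e2
    rw [e1, e2, smul_eq_mul]
  have hc : coeff (cosL k) (hv'.toLp v') = ∫ t in (0 : ℝ)..1, cosMode k t * v' t := by
    rw [coeff, ← integral_timeMeas]
    refine integral_congr_ae ?_
    filter_upwards [hv'.coeFn_toLp, coeFn_cosL k] with t e1 e2
    rw [e1, e2, smul_eq_mul]
  have hcos : ∀ t, HasDerivAt (cosMode k) (-(√(eigval k) * sinMode k t)) t := by
    intro t
    have h := (((hasDerivAt_id t).const_mul (Real.pi / 2 + k * Real.pi)).cos).const_mul (√2)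
    rw [sqrt_eigval]
    exact h.congr_deriv (by simp only [sinMode, id]; ring)
  have hW : cosMode k 1 = 0 := by
    have : Real.cos (Real.pi / 2 + k * Real.pi) = 0 := by
      rw [Real.cos_add_nat_mul_pi]; simp
    simp [cosMode, this]
  have hvi : IntervalIntegrable v' volume 0 1 := by
    rw [intervalIntegrable_iff_integrableOn_Ioo_of_le zero_le_one]
    exact hv'.integrable one_le_two
  rw [hc, intervalIntegral.integral_mul_deriv_eq_deriv_mul_of_hasDeriv_right
    (continuous_cosMode k).continuousOn (by rwa [uIcc_of_le zero_le_one])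
    (fun t _ => (hcos t).hasDerivWithinAt)
    (fun t ht => hd t (by simpa using ht))
    (Continuous.intervalIntegrable (by have := continuous_sinMode k; fun_prop) _ _) hvi,
    hs, hW, hv0, zero_mul, mul_zero, sub_zero, zero_sub, ← intervalIntegral.integral_neg,
    ← intervalIntegral.integral_const_mul]
  exact intervalIntegral.integral_congr fun t _ => by ring

lemma timeSpace_le_halfSpace (N d : ℕ) [NeZero N] : timeSpace N d ≤ halfSpace sinL ℝ := by
  rintro z ⟨v, hv, hv0, hp, hz⟩
  choose p hpd hp using hp
  have hN' : (0 : ℝ) < N := by exact_mod_cast NeZero.pos N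
  -- The cells are half-open on the right, so at a node the sum selects the polynomial of the cell
  -- to its right, which is the one giving the right derivative.
  refine mem_halfSpace_sinL_of_hasDerivWithinAt hz hv hv0 (v' := fun t => ∑ l : Fin N,
    (Ico ((l : ℝ) / N) ((l + 1 : ℝ) / N)).indicator (fun s => (p l).derivative.eval s) t) ?_ ?_
  · exact memLp_finsetSum _ fun l _ => (memLp_timeMeas_of_continuous
      (p l).derivative.continuous).indicator measurableSet_Ico
  · intro t ht
    -- `⌊tN⌋` is the index of the only cell containing `t`.
    set m : ℕ := ⌊t * N⌋₊ with hm
    have hm1 : (m : ℝ) ≤ t * N := Nat.floor_le (by have := ht.1; positivity)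
    have hm2 : t * N < m + 1 := Nat.lt_floor_add_one _
    have hmN : m < N := by
      have : (m : ℝ) < N := by nlinarith [ht.2]
      exact_mod_cast this
    have hmem : ∀ j : Fin N, t ∈ Ico ((j : ℝ) / N) ((j + 1 : ℝ) / N) ↔ j = ⟨m, hmN⟩ := by
      intro j
      rw [mem_Ico, div_le_iff₀ hN', lt_div_iff₀ hN', Fin.ext_iff,
        ← Nat.floor_eq_iff (by have := ht.1; positivity : 0 ≤ t * N)]
      exact eq_comm
    have htm := (hmem ⟨m, hmN⟩).2 rfl
    rw [Finset.sum_eq_single (⟨m, hmN⟩ : Fin N) (fun j _ hj =>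
      indicator_of_notMem (fun h => hj ((hmem j).1 h)) _) (by simp), indicator_of_mem htm]
    refine ((p ⟨m, hmN⟩).hasDerivAt t).hasDerivWithinAt.congr_of_eventuallyEq ?_
      (hp _ t ⟨htm.1, htm.2.le⟩)
    filter_upwards [Ioo_mem_nhdsGT htm.2] with s hs
    exact hp _ s ⟨htm.1.trans hs.1.le, hs.2.le⟩

lemma dyad_mem_halfSpace [CompleteSpace H] {e : ℕ → L2T ℝ} {φ : L2T ℝ} (hφ : φ ∈ halfSpace e ℝ)
    (h : H) : dyad φ h ∈ halfSpace e H := by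
  have hs : Summable fun k => √(eigval k) * ‖coeff (e k) φ‖ ^ 2 := hφ
  refine (hs.mul_right (‖h‖ ^ 2)).congr fun k => ?_
  rw [coeff_dyad, norm_smul, mul_pow, coeff_eq_inner, mul_assoc]

end HalfNorm

/-! ### Time coefficients and the modified Hilbert transform on elementary tensors -/

section Operator

variable {H : Type*} [NormedAddCommGroup H] [InnerProductSpace ℝ H]

lemma inner_compLp_sub_left (T : H →L[ℝ] H) (u v w : L2T H) :
    inner ℝ (T.compLp (u - v)) w = inner ℝ (T.compLp u) w - inner ℝ (T.compLp v) w := by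
  rw [← inner_sub_left]
  exact congrArg (fun x => inner ℝ x w) (map_sub (T.compLpL 2 timeMeas) u v)

lemma inner_dyad_right [CompleteSpace H] (u : L2T H) (φ : L2T ℝ) (h : H) :
    inner ℝ u (dyad φ h) = inner ℝ (coeff φ u) h := by
  rw [real_inner_comm, inner_dyad, real_inner_comm]

lemma inner_compLp_dyad [CompleteSpace H] (T : H →L[ℝ] H) (u : L2T H) (φ : L2T ℝ) (h : H) :
    inner ℝ (T.compLp u) (dyad φ h) = inner ℝ (T (coeff φ u)) h := by
  rw [inner_dyad_right, coeff_compLp]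

/-- The cosine coefficients of `hilbertT` are known explicitly, so its algebraic properties can be
checked coefficientwise without handling the series. -/
lemma eq_of_coeff_cosL_eq [CompleteSpace H] {u v : L2T H}
    (h : ∀ k, coeff (cosL k) u = coeff (cosL k) v) : u = v :=
  sub_eq_zero.1 <| eq_zero_of_coeff_cosL fun k => by rw [coeff_sub, h, sub_self]

lemma hilbertT_add [CompleteSpace H] (u v : L2T H) :
    hilbertT (u + v) = hilbertT u + hilbertT v :=
  eq_of_coeff_cosL_eq fun k => by
    rw [coeff_add, coeff_cosL_hilbertT, coeff_cosL_hilbertT, coeff_cosL_hilbertT, coeff_add]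

lemma hilbertT_smul [CompleteSpace H] (c : ℝ) (u : L2T H) :
    hilbertT (c • u) = c • hilbertT u :=
  eq_of_coeff_cosL_eq fun k => by
    rw [coeff_smul, coeff_cosL_hilbertT, coeff_cosL_hilbertT, coeff_smul]

lemma hilbertT_zero [CompleteSpace H] : hilbertT (0 : L2T H) = 0 := by
  simpa using hilbertT_smul 0 (0 : L2T H)

/-- The transform leaves the spatial factor untouched; this keeps `Sx` available for the Ritz
property. -/
lemma hilbertT_dyad [CompleteSpace H] (φ : L2T ℝ) (h : H) :
    hilbertT (dyad φ h) = dyad (hilbertT φ) h :=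
  eq_of_coeff_cosL_eq fun k => by
    rw [coeff_cosL_hilbertT, coeff_dyad, coeff_dyad, ← coeff_eq_inner, ← coeff_eq_inner,
      coeff_cosL_hilbertT]

end Operator

section SpatialForm

variable {n : ℕ} {Ω ΓD : Set (Eu n)}

/-! ### The spatial form as a bounded operator on `H¹_{Γ_D}(Ω)` -/

lemma mulVec_dotProduct_eq_sum (M : Matrix (Fin n) (Fin n) ℝ) (a b : Fin n → ℝ) :
    M.mulVec a ⬝ᵥ b = ∑ i, ∑ j, M i j * (a j * b i) := by
  simp only [dotProduct, Matrix.mulVec, Finset.sum_mul]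
  exact Finset.sum_congr rfl fun i _ => Finset.sum_congr rfl fun j _ => by ring

lemma abs_mulVec_dotProduct_le {M : Matrix (Fin n) (Fin n) ℝ} {C : ℝ} (hM : ∀ i j, |M i j| ≤ C)
    (a b : Eu n) : |M.mulVec a.ofLp ⬝ᵥ b.ofLp| ≤ (n * n * C) * (‖a‖ * ‖b‖) := by
  have hterm : ∀ i j, |M i j * (a j * b i)| ≤ C * (‖a‖ * ‖b‖) := by
    intro i j
    have h1 : |a j| ≤ ‖a‖ := PiLp.norm_apply_le a j
    have h2 : |b i| ≤ ‖b‖ := PiLp.norm_apply_le b i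
    have h3 := hM i j
    rw [abs_mul, abs_mul]
    have hC : 0 ≤ C := (abs_nonneg _).trans h3
    gcongr
  rw [mulVec_dotProduct_eq_sum]
  calc |∑ i, ∑ j, M i j * (a j * b i)| ≤ ∑ i, ∑ j, |M i j * (a j * b i)| :=
        (Finset.abs_sum_le_sum_abs _ _).trans
          (Finset.sum_le_sum fun i _ => Finset.abs_sum_le_sum_abs _ _)
    _ ≤ ∑ _i : Fin n, ∑ _j : Fin n, C * (‖a‖ * ‖b‖) :=
        Finset.sum_le_sum fun i _ => Finset.sum_le_sum fun j _ => hterm i j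
    _ = (n * n * C) * (‖a‖ * ‖b‖) := by simp; ring

lemma integrable_norm_mul_norm {α E : Type*} [MeasurableSpace α] {μ : Measure α}
    [NormedAddCommGroup E] (a b : Lp E 2 μ) : Integrable (fun x => ‖a x‖ * ‖b x‖) μ :=
  (Lp.memLp a).norm.integrable_mul (Lp.memLp b).norm

lemma integral_norm_mul_norm_le {α E : Type*} [MeasurableSpace α] {μ : Measure α}
    [NormedAddCommGroup E] (a b : Lp E 2 μ) : ∫ x, ‖a x‖ * ‖b x‖ ∂μ ≤ ‖a‖ * ‖b‖ := by
  have h := real_inner_le_norm ((Lp.memLp a).norm.toLp _) ((Lp.memLp b).norm.toLp _)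
  rw [Lp.norm_toLp, Lp.norm_toLp, eLpNorm_norm, eLpNorm_norm, ← Lp.norm_def, ← Lp.norm_def,
    L2.inner_def] at h
  refine le_of_eq_of_le (integral_congr_ae ?_) h
  filter_upwards [(Lp.memLp a).norm.coeFn_toLp, (Lp.memLp b).norm.coeFn_toLp] with x h1 h2
  rw [h1, h2]
  simp [mul_comm]

variable {A : Eu n → Matrix (Fin n) (Fin n) ℝ}

lemma IsDiffusionCoefficient.integrable_form (hA : IsDiffusionCoefficient Ω A) (a b : L2Xn Ω) :
    Integrable (fun x => (A x).mulVec (a x).ofLp ⬝ᵥ (b x).ofLp) (volume.restrict Ω) := by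
  obtain ⟨M, hM⟩ := hA.bounded
  refine ((integrable_norm_mul_norm a b).const_mul (n * n * M)).mono' ?_ ?_
  · simp only [mulVec_dotProduct_eq_sum]
    refine Finset.aestronglyMeasurable_fun_sum _ fun i _ =>
      Finset.aestronglyMeasurable_fun_sum _ fun j _ => (hA.measurable i j).mul (.mul ?_ ?_)
    · exact (EuclideanSpace.proj j : Eu n →L[ℝ] ℝ).continuous.comp_aestronglyMeasurable
        (Lp.aestronglyMeasurable a)
    · exact (EuclideanSpace.proj i : Eu n →L[ℝ] ℝ).continuous.comp_aestronglyMeasurable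
        (Lp.aestronglyMeasurable b)
  · filter_upwards [hM] with x hx
    exact abs_mulVec_dotProduct_le hx _ _

lemma formX_add_left (hA : IsDiffusionCoefficient Ω A) (v v' w : H1D Ω ΓD) :
    formX Ω ΓD A (v + v') w = formX Ω ΓD A v w + formX Ω ΓD A v' w := by
  unfold formX
  rw [← integral_add (hA.integrable_form _ _) (hA.integrable_form _ _), map_add]
  refine integral_congr_ae ?_
  filter_upwards [Lp.coeFn_add (gradX Ω ΓD v) (gradX Ω ΓD v')] with x hx
  rw [hx, Pi.add_apply, WithLp.ofLp_add, Matrix.mulVec_add, add_dotProduct]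

lemma formX_smul_left (c : ℝ) (v w : H1D Ω ΓD) :
    formX Ω ΓD A (c • v) w = c * formX Ω ΓD A v w := by
  unfold formX
  rw [← integral_const_mul, map_smul]
  refine integral_congr_ae ?_
  filter_upwards [Lp.coeFn_smul c (gradX Ω ΓD v)] with x hx
  rw [hx, Pi.smul_apply, WithLp.ofLp_smul, Matrix.mulVec_smul, smul_dotProduct, smul_eq_mul]

lemma formX_symm (hA : IsDiffusionCoefficient Ω A) (v w : H1D Ω ΓD) :
    formX Ω ΓD A v w = formX Ω ΓD A w v := by
  unfold formX
  refine integral_congr_ae ?_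
  filter_upwards [hA.symm] with x hx
  rw [dotProduct_comm, Matrix.dotProduct_mulVec, ← Matrix.mulVec_transpose, hx]

lemma formX_self_nonneg (hA : IsDiffusionCoefficient Ω A) (v : H1D Ω ΓD) :
    0 ≤ formX Ω ΓD A v v := by
  obtain ⟨α, hα, h⟩ := hA.elliptic
  refine integral_nonneg_of_ae ?_
  filter_upwards [h] with x hx
  rw [Pi.zero_apply, dotProduct_comm]
  exact (mul_nonneg hα.le (Finset.sum_nonneg fun i _ => mul_self_nonneg _)).trans (hx _)

lemma norm_gradX_le (v : H1D Ω ΓD) : ‖gradX Ω ΓD v‖ ≤ ‖v‖ := by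
  have h := WithLp.prod_norm_sq_eq_of_L2 (v : WithLp 2 (L2X Ω × L2Xn Ω))
  have h1 : ‖(v : WithLp 2 (L2X Ω × L2Xn Ω))‖ = ‖v‖ := rfl
  have h2 : gradX Ω ΓD v = (v : WithLp 2 (L2X Ω × L2Xn Ω)).snd := rfl
  rw [h2, ← h1]
  refine abs_le_of_sq_le_sq' ?_ (norm_nonneg _) |>.2
  rw [h]
  exact le_add_of_nonneg_left (sq_nonneg _)

lemma exists_abs_formX_le (hA : IsDiffusionCoefficient Ω A) :
    ∃ C : ℝ, ∀ v w : H1D Ω ΓD, |formX Ω ΓD A v w| ≤ C * ‖v‖ * ‖w‖ := by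
  obtain ⟨M, hM⟩ := hA.bounded
  -- The essential bound is not known to be nonnegative; passing to `max M 0` makes the final
  -- constant so.
  have hM' : ∀ᵐ x ∂volume.restrict Ω, ∀ i j, |A x i j| ≤ max M 0 := by
    filter_upwards [hM] with x hx i j
    exact (hx i j).trans (le_max_left _ _)
  refine ⟨n * n * max M 0, fun v w => ?_⟩
  have h1 : |formX Ω ΓD A v w| ≤
      ∫ x in Ω, (n * n * max M 0) * (‖gradX Ω ΓD v x‖ * ‖gradX Ω ΓD w x‖) := by
    rw [formX, ← Real.norm_eq_abs]
    refine norm_integral_le_of_norm_le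
      ((integrable_norm_mul_norm (gradX Ω ΓD v) (gradX Ω ΓD w)).const_mul _) ?_
    filter_upwards [hM'] with x hx
    exact abs_mulVec_dotProduct_le hx _ _
  rw [integral_const_mul] at h1
  refine h1.trans ?_
  rw [mul_assoc _ ‖v‖]
  have hC : 0 ≤ (n * n * max M 0 : ℝ) := by positivity
  refine mul_le_mul_of_nonneg_left ((integral_norm_mul_norm_le _ _).trans ?_) hC
  exact mul_le_mul (norm_gradX_le v) (norm_gradX_le w) (norm_nonneg _) (norm_nonneg _)

/-- The bounded operator on `H¹_{Γ_D}(Ω)` that represents the spatial form. -/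
lemma exists_formX_eq_inner (hA : IsDiffusionCoefficient Ω A) :
    ∃ T : H1D Ω ΓD →L[ℝ] H1D Ω ΓD, ∀ v w, formX Ω ΓD A v w = inner ℝ (T v) w := by
  obtain ⟨C, hC⟩ := exists_abs_formX_le (ΓD := ΓD) hA
  let B : H1D Ω ΓD →L[ℝ] H1D Ω ΓD →L[ℝ] ℝ := LinearMap.mkContinuous₂
    (LinearMap.mk₂ ℝ (formX Ω ΓD A) (formX_add_left hA) formX_smul_left
      (fun v w w' => by
        rw [formX_symm hA, formX_add_left hA, formX_symm hA w, formX_symm hA w'])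
      (fun c v w => by
        rw [formX_symm hA, formX_smul_left, formX_symm hA w, smul_eq_mul])) C hC
  exact ⟨InnerProductSpace.continuousLinearMapOfBilin B, fun v w =>
    (InnerProductSpace.continuousLinearMapOfBilin_apply B v w).symm⟩

/-- Applying `T` pointwise in time turns the space-time form into an inner product of `L²(I; H¹)`,
from which linearity, positivity and the action on elementary tensors are all read off. -/
lemma formQ_eq_inner_compLp {T : H1D Ω ΓD →L[ℝ] H1D Ω ΓD}
    (hT : ∀ v w, formX Ω ΓD A v w = inner ℝ (T v) w) (u w : L2T (H1D Ω ΓD)) :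
    formQ A u w = inner ℝ (T.compLp u) w := by
  rw [formQ, L2.inner_def]
  refine integral_congr_ae ?_
  filter_upwards [T.coeFn_compLp u] with t ht
  rw [ht, hT]

end SpatialForm

section ErrorEstimate

variable {n : ℕ} {Ω ΓD : Set (Eu n)} {A : Eu n → Matrix (Fin n) (Fin n) ℝ}

/-! ### The space-time error estimate -/

lemma formQ_sub_left (hA : IsDiffusionCoefficient Ω A) (u v w : L2T (H1D Ω ΓD)) :
    formQ A (u - v) w = formQ A u w - formQ A v w := by
  obtain ⟨T, hT⟩ := exists_formX_eq_inner (ΓD := ΓD) hA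
  rw [formQ_eq_inner_compLp hT, formQ_eq_inner_compLp hT, formQ_eq_inner_compLp hT]
  exact inner_compLp_sub_left T u v w

lemma formQ_add_right (hA : IsDiffusionCoefficient Ω A) (u v w : L2T (H1D Ω ΓD)) :
    formQ A u (v + w) = formQ A u v + formQ A u w := by
  obtain ⟨T, hT⟩ := exists_formX_eq_inner (ΓD := ΓD) hA
  rw [formQ_eq_inner_compLp hT, formQ_eq_inner_compLp hT, formQ_eq_inner_compLp hT]
  exact inner_add_right (𝕜 := ℝ) (T.compLp u) v w

lemma formQ_smul_right (hA : IsDiffusionCoefficient Ω A) (u : L2T (H1D Ω ΓD)) (c : ℝ)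
    (w : L2T (H1D Ω ΓD)) : formQ A u (c • w) = c * formQ A u w := by
  obtain ⟨T, hT⟩ := exists_formX_eq_inner (ΓD := ΓD) hA
  rw [formQ_eq_inner_compLp hT, formQ_eq_inner_compLp hT]
  exact real_inner_smul_right (T.compLp u) w c

lemma formQ_zero_right (hA : IsDiffusionCoefficient Ω A) (u : L2T (H1D Ω ΓD)) :
    formQ A u 0 = 0 := by
  simpa using formQ_smul_right hA u 0 0

lemma formQ_hilbertT_nonneg (hA : IsDiffusionCoefficient Ω A) (v : L2T (H1D Ω ΓD)) :
    0 ≤ formQ A v (hilbertT v) := by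
  obtain ⟨T, hT⟩ := exists_formX_eq_inner (ΓD := ΓD) hA
  rw [formQ_eq_inner_compLp hT]
  refine inner_compLp_hilbertT_nonneg (fun v w => ?_) (fun v => ?_) v
  · rw [← hT, ← hT, formX_symm hA]
  · rw [← hT]; exact formX_self_nonneg hA v

lemma formQ_dyad_right (hA : IsDiffusionCoefficient Ω A) (u : L2T (H1D Ω ΓD)) (φ : L2T ℝ)
    (ψ : H1D Ω ΓD) : formQ A u (dyad φ ψ) = formX Ω ΓD A (coeff φ u) ψ := by
  obtain ⟨T, hT⟩ := exists_formX_eq_inner (ΓD := ΓD) hA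
  rw [formQ_eq_inner_compLp hT, hT]
  exact inner_compLp_dyad T u φ ψ

lemma valQ_sub (u v : L2T (H1D Ω ΓD)) : valQ (u - v) = valQ u - valQ v :=
  map_sub ((valX Ω ΓD).compLpL 2 timeMeas) u v

lemma mem_trialQ {v : L2T (H1D Ω ΓD)} : v ∈ trialQ Ω ΓD ↔ valQ v ∈ halfSpace sinL (L2X Ω) := Iff.rfl

lemma mem_testQ {v : L2T (H1D Ω ΓD)} : v ∈ testQ Ω ΓD ↔ valQ v ∈ halfSpace cosL (L2X Ω) := Iff.rfl

lemma valQ_dyad (φ : L2T ℝ) (ψ : H1D Ω ΓD) : valQ (dyad φ ψ) = dyad φ (valX Ω ΓD ψ) :=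
  compLp_dyad _ _ _

lemma coeff_cosL_valQ_hilbertT (v : L2T (H1D Ω ΓD)) (k : ℕ) :
    coeff (cosL k) (valQ (hilbertT v)) = coeff (sinL k) (valQ v) := by
  rw [valQ, valQ, coeff_compLp, coeff_compLp, coeff_cosL_hilbertT]

lemma halfNorm_valQ_hilbertT (v : L2T (H1D Ω ΓD)) :
    halfNorm cosL (valQ (hilbertT v)) = halfNorm sinL (valQ v) := by
  simp only [halfNorm, coeff_cosL_valQ_hilbertT]

/-- The pairing becomes diagonal: each mode contributes `√λ_k ‖v_k‖²`. This exact coercivity of the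
time derivative is the reason for testing with `H_T v`. -/
lemma derivPairing_hilbertT (v : L2T (H1D Ω ΓD)) :
    derivPairing (valQ v) (valQ (hilbertT v)) = halfNorm sinL (valQ v) ^ 2 := by
  rw [halfNorm, Real.sq_sqrt (tsum_nonneg fun k => by positivity)]
  simp only [derivPairing, coeff_cosL_valQ_hilbertT, real_inner_self_eq_norm_sq]

lemma formB_sub_left (hA : IsDiffusionCoefficient Ω A) {u v w : L2T (H1D Ω ΓD)}
    (hu : u ∈ trialQ Ω ΓD) (hv : v ∈ trialQ Ω ΓD) (hw : w ∈ testQ Ω ΓD) :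
    formB A (u - v) w = formB A u w - formB A v w := by
  rw [formB, formB, formB, valQ_sub, derivPairing_sub_left (mem_trialQ.1 hu) (mem_trialQ.1 hv)
    (mem_testQ.1 hw), formQ_sub_left hA]
  ring

lemma trialSpace_le_trialQ (Sx : Submodule ℝ (H1D Ω ΓD)) {St : Submodule ℝ (L2T ℝ)}
    (hSt : St ≤ halfSpace sinL ℝ) : trialSpace Sx St ≤ trialQ Ω ΓD := by
  refine Submodule.span_le.2 ?_
  rintro z ⟨ψ, -, φ, hφ, rfl⟩
  rw [SetLike.mem_coe, mem_trialQ, valQ_dyad]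
  exact dyad_mem_halfSpace (hSt hφ) _

lemma tensorOp_mem_trialSpace {Sx : Submodule ℝ (H1D Ω ΓD)} (St : Submodule ℝ (L2T ℝ))
    [FiniteDimensional ℝ St] (Pt : L2T ℝ →L[ℝ] L2T ℝ) {Px : H1D Ω ΓD →ₗ[ℝ] H1D Ω ΓD}
    (hPx : ∀ z, Px z ∈ Sx) (u : L2T (H1D Ω ΓD)) : tensorOp St Pt Px u ∈ trialSpace Sx St :=
  Submodule.sum_mem _ fun i _ =>
    Submodule.subset_span ⟨_, hPx _, _, (stdOrthonormalBasis ℝ St i).2, rfl⟩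

/-! ### Consistency error and removal of the Ritz projection -/

lemma cosL_mem_halfSpace (k : ℕ) : cosL k ∈ halfSpace cosL ℝ := by
  refine summable_of_ne_finset_zero (s := {k}) fun j hj => ?_
  rw [coeff_eq_inner, inner_cosL, if_neg (by simpa using hj)]
  simp

/-- The strong form `ℒ_x u = g` tested with an arbitrary temporal factor in `L²(I)`. -/
lemma formX_coeff_eq_inner (hA : IsDiffusionCoefficient Ω A) {u : L2T (H1D Ω ΓD)}
    {g : L2T (L2X Ω)} (hg : IsSpatialOperator A u g) (φ : L2T ℝ) (ψ : H1D Ω ΓD) :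
    formX Ω ΓD A (coeff φ u) ψ = inner ℝ (coeff φ g) (valX Ω ΓD ψ) := by
  obtain ⟨T, hT⟩ := exists_formX_eq_inner (ΓD := ΓD) hA
  -- `D(t)` is the residual `⟨A∇u(t), ∇ψ⟩ - ⟨g(t), ψ⟩`, a scalar function of time.
  set D : L2T ℝ := (innerSL ℝ ψ).compLp (T.compLp u) - (innerSL ℝ (valX Ω ΓD ψ)).compLp g with hD
  have hc : ∀ χ : L2T ℝ, coeff χ D
      = formX Ω ΓD A (coeff χ u) ψ - inner ℝ (coeff χ g) (valX Ω ΓD ψ) := by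
    intro χ
    rw [hD, coeff_sub, coeff_compLp, coeff_compLp, coeff_compLp, innerSL_apply_apply,
      innerSL_apply_apply, hT, real_inner_comm ψ, real_inner_comm (valX Ω ΓD ψ)]
  -- The functions `W_k ⊗ ψ` are admissible tests, and the `W_k` are total in `L²(I)`. Hence `D =
  -- 0`, and factors such as `P* b_i`, known only to lie in `L²(I)`, become admissible too.
  have h0 : D = 0 := eq_zero_of_coeff_cosL fun k => by
    have h := hg (dyad (cosL k) ψ) (by
      rw [mem_testQ, valQ_dyad]; exact dyad_mem_halfSpace (cosL_mem_halfSpace k) _)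
    rw [formQ_dyad_right hA, valQ_dyad, inner_dyad_right] at h
    rw [hc, h, sub_self]
  have h1 := hc φ
  rw [h0, coeff_zero] at h1
  exact (sub_eq_zero.1 h1.symm)

lemma formX_sum_left (hA : IsDiffusionCoefficient Ω A) {ι : Type*} (s : Finset ι)
    (v : ι → H1D Ω ΓD) (w : H1D Ω ΓD) :
    formX Ω ΓD A (∑ i ∈ s, v i) w = ∑ i ∈ s, formX Ω ΓD A (v i) w := by
  obtain ⟨T, hT⟩ := exists_formX_eq_inner (ΓD := ΓD) hA
  simp only [hT, map_sum, sum_inner]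

lemma coeff_tensorOp {H K : Type*} [NormedAddCommGroup H] [InnerProductSpace ℝ H]
    [NormedAddCommGroup K] [InnerProductSpace ℝ K] [CompleteSpace K]
    (St : Submodule ℝ (L2T ℝ)) [FiniteDimensional ℝ St] (Pt : L2T ℝ →L[ℝ] L2T ℝ) (L : H →ₗ[ℝ] K)
    (u : L2T H) (φ : L2T ℝ) :
    coeff φ (tensorOp St Pt L u) = ∑ i, (inner ℝ φ (stdOrthonormalBasis ℝ St i : L2T ℝ) : ℝ) •
      L (coeff (ContinuousLinearMap.adjoint Pt (stdOrthonormalBasis ℝ St i : L2T ℝ)) u) := by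
  refine ext_inner_left ℝ fun k => ?_
  rw [← inner_dyad, tensorOp, inner_sum, inner_sum]
  refine Finset.sum_congr rfl fun i _ => ?_
  rw [inner_dyad, coeff_dyad]

/-- The Ritz projection disappears when the form is tested with `S^x`-valued functions. -/
lemma formX_coeff_tensorOp (hA : IsDiffusionCoefficient Ω A) {u : L2T (H1D Ω ΓD)}
    {g : L2T (L2X Ω)} (hg : IsSpatialOperator A u g) {Sx : Submodule ℝ (H1D Ω ΓD)}
    (St : Submodule ℝ (L2T ℝ)) [FiniteDimensional ℝ St] (Pt : L2T ℝ →L[ℝ] L2T ℝ)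
    {Px : H1D Ω ΓD →ₗ[ℝ] H1D Ω ΓD} (hPx : IsRitzProjection A Sx Px) (φ : L2T ℝ) {ψ : H1D Ω ΓD}
    (hψ : ψ ∈ Sx) : formX Ω ΓD A (coeff φ (tensorOp St Pt Px u)) ψ
      = inner ℝ (coeff φ (tensorOp St Pt LinearMap.id g)) (valX Ω ΓD ψ) := by
  rw [coeff_tensorOp, coeff_tensorOp, formX_sum_left hA, sum_inner]
  refine Finset.sum_congr rfl fun i _ => ?_
  -- For each basis index, the Ritz property removes `Px`, and the strong form with temporal factor
  -- `P* b_i` replaces the form by a pairing with `g`.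
  rw [formX_smul_left, (hPx _).2 ψ hψ, formX_coeff_eq_inner hA hg, real_inner_smul_left,
    LinearMap.id_apply]

lemma valQ_add (u v : L2T (H1D Ω ΓD)) : valQ (u + v) = valQ u + valQ v :=
  map_add ((valX Ω ΓD).compLpL 2 timeMeas) u v

lemma valQ_smul (c : ℝ) (u : L2T (H1D Ω ΓD)) : valQ (c • u) = c • valQ u :=
  map_smul ((valX Ω ΓD).compLpL 2 timeMeas) c u

lemma valQ_zero : valQ (0 : L2T (H1D Ω ΓD)) = 0 :=
  map_zero ((valX Ω ΓD).compLpL 2 timeMeas)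

/-- Consistency error of the projected solution, tested with `H_T S`. -/
lemma formQ_sub_tensorOp (hA : IsDiffusionCoefficient Ω A) {u : L2T (H1D Ω ΓD)}
    {g : L2T (L2X Ω)} (hg : IsSpatialOperator A u g) {Sx : Submodule ℝ (H1D Ω ΓD)}
    (St : Submodule ℝ (L2T ℝ)) [FiniteDimensional ℝ St] (Pt : L2T ℝ →L[ℝ] L2T ℝ)
    {Px : H1D Ω ΓD →ₗ[ℝ] H1D Ω ΓD} (hPx : IsRitzProjection A Sx Px) {v : L2T (H1D Ω ΓD)}
    (hv : v ∈ trialSpace Sx St) : formQ A (u - tensorOp St Pt Px u) (hilbertT v)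
      = inner ℝ (g - tensorOp St Pt LinearMap.id g) (valQ (hilbertT v)) := by
  induction hv using Submodule.span_induction with
  | mem v hv =>
    obtain ⟨ψ, hψ, φ, -, rfl⟩ := hv
    -- The temporal factor is now `hilbertT φ`, used only as an element of `L²(I)`; the spatial
    -- factor `ψ` is still in `Sx`.
    rw [hilbertT_dyad, formQ_sub_left hA, formQ_dyad_right hA, formQ_dyad_right hA,
      formX_coeff_eq_inner hA hg, formX_coeff_tensorOp hA hg St Pt hPx _ hψ, ← inner_sub_left,
      ← coeff_sub, valQ_dyad, inner_dyad_right]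
  | zero => rw [hilbertT_zero, valQ_zero, inner_zero_right, formQ_zero_right hA]
  | add v w _ _ hv hw =>
    rw [hilbertT_add, valQ_add, inner_add_right, formQ_add_right hA, hv, hw]
  | smul c v _ hv =>
    rw [hilbertT_smul, valQ_smul, inner_smul_right, formQ_smul_right hA, hv]

/-- The quasi-optimal estimate for an abstract tensor-product trial space. -/
theorem halfNorm_sub_galerkin_le (hA : IsDiffusionCoefficient Ω A)
    {f : testQ Ω ΓD →ₗ[ℝ] ℝ} {u : L2T (H1D Ω ΓD)} (hu : IsVariationalSolution A f u)
    {g : L2T (L2X Ω)} (hg : IsSpatialOperator A u g) {Sx : Submodule ℝ (H1D Ω ΓD)}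
    {St : Submodule ℝ (L2T ℝ)} [FiniteDimensional ℝ St] (hSt : St ≤ halfSpace sinL ℝ)
    {uj : L2T (H1D Ω ΓD)} (huj : IsGalerkinSolution A f (trialSpace Sx St) uj)
    (Pt : L2T ℝ →L[ℝ] L2T ℝ) {Px : H1D Ω ΓD →ₗ[ℝ] H1D Ω ΓD} (hPx : IsRitzProjection A Sx Px) :
    halfNorm sinL (valQ (u - uj)) ≤ 2 * halfNorm sinL (valQ (u - tensorOp St Pt Px u))
      + dualHalfNorm (g - tensorOp St Pt LinearMap.id g) := by
  set Pu := tensorOp St Pt Px u with hPu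
  have hSX := trialSpace_le_trialQ Sx hSt
  have hPuS : Pu ∈ trialSpace Sx St := tensorOp_mem_trialSpace St Pt (fun z => (hPx z).1) u
  have hvS : uj - Pu ∈ trialSpace Sx St := sub_mem huj.1 hPuS
  have hvX := hSX hvS
  have hw : hilbertT (uj - Pu) ∈ testQ Ω ΓD := hilbertT_mem_testQ hvX
  have hPuX := hSX hPuS
  have hujX := hSX huj.1
  -- Galerkin orthogonality: `hilbertT` of a discrete function is admissible in both the discrete
  -- and the continuous problem.
  have horth : formB A uj (hilbertT (uj - Pu)) = formB A u (hilbertT (uj - Pu)) := by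
    rw [huj.2 _ hvS hvX, hu.2 ⟨_, hw⟩]
  have hB : formB A (uj - Pu) (hilbertT (uj - Pu)) = formB A (u - Pu) (hilbertT (uj - Pu)) := by
    rw [formB_sub_left hA hujX hPuX hw, formB_sub_left hA hu.1 hPuX hw, horth]
  have hpos := formQ_hilbertT_nonneg hA (uj - Pu)
  have hd : derivPairing (valQ (u - Pu)) (valQ (hilbertT (uj - Pu)))
      ≤ halfNorm sinL (valQ (u - Pu)) * halfNorm cosL (valQ (hilbertT (uj - Pu))) :=
    derivPairing_le (mem_trialQ.1 (sub_mem hu.1 hPuX)) (mem_testQ.1 hw)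
  have hc := inner_le_dualHalfNorm_mul (g - tensorOp St Pt LinearMap.id g) (mem_testQ.1 hw)
  rw [formB, formB, derivPairing_hilbertT, hPu, formQ_sub_tensorOp hA hg St Pt hPx hvS,
    ← hPu] at hB
  rw [halfNorm_valQ_hilbertT] at hd hc
  have hle : halfNorm sinL (valQ (uj - Pu)) ≤ halfNorm sinL (valQ (u - Pu))
      + dualHalfNorm (g - tensorOp St Pt LinearMap.id g) := by
    -- Division by the norm of `v = uj - Pu` needs it positive. If it is zero, the right side must
    -- be seen to be nonnegative: the supremum defining the dual norm is over a bounded set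
    -- containing the value `0`, attained at `w = 0`.
    rcases (halfNorm_nonneg sinL (valQ (uj - Pu))).eq_or_lt with h0 | h0
    · rw [← h0]
      refine add_nonneg (halfNorm_nonneg _ _) ?_
      exact le_csSup (bddAbove_dualHalfNorm _) ⟨0, zero_mem _, by simp [halfNorm, coeff_zero],
        (inner_zero_right _).symm⟩
    · refine le_of_mul_le_mul_right ?_ h0
      -- By `hB`, dropping the nonnegative elliptic term, `‖v‖²` is at most the sum of the bounds
      -- `hd` and `hc`, each of which carries a factor `‖v‖`.
      nlinarith
  have htri : halfNorm sinL (valQ (u - uj))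
      ≤ halfNorm sinL (valQ (u - Pu)) + halfNorm sinL (valQ (uj - Pu)) := by
    have h := halfNorm_add_le (mem_trialQ.1 (sub_mem hu.1 hPuX))
      (mem_trialQ.1 (sub_mem hPuX hujX))
    rwa [← valQ_add, sub_add_sub_cancel, valQ_sub Pu, halfNorm_sub_comm (valQ Pu),
      ← valQ_sub] at h
  linarith

end ErrorEstimate

end SpaceTimeHeat

/-! ### The estimate for continuous piecewise polynomials in time and finite elements in space -/

theorem theorem3p1 {n : ℕ} (Ω ΓD : Set (Eu n))
    (hΩ_open : IsOpen Ω) (hΩ_conn : IsConnected Ω) (hΩ_bdd : Bornology.IsBounded Ω)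
    (hD_closed : IsClosed ΓD) (hD_ne : ΓD.Nonempty) (hD_sub : ΓD ⊆ frontier Ω)
    (A : Eu n → Matrix (Fin n) (Fin n) ℝ) (hA : IsDiffusionCoefficient Ω A)
    (T : SpatialMesh Ω) (p : ℕ) (N d : ℕ) [NeZero N]
    (f : testQ Ω ΓD →ₗ[ℝ] ℝ) (hf : IsBoundedFunctional f)
    (u : L2T (H1D Ω ΓD)) (hu : IsVariationalSolution A f u)
    (g : L2T (L2X Ω)) (hg : IsSpatialOperator A u g)
    (uj : L2T (H1D Ω ΓD))
    (huj : IsGalerkinSolution A f (trialSpace (femSpace ΓD T p) (timeSpace N d)) uj)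
    (Pt : L2T ℝ →L[ℝ] L2T ℝ) (hPt : IsTemporalProjection (timeSpace N d) Pt)
    (Px : H1D Ω ΓD →ₗ[ℝ] H1D Ω ΓD) (hPx : IsRitzProjection A (femSpace ΓD T p) Px) :
    trialSpace (femSpace ΓD T p) (timeSpace N d) ≤ trialQ Ω ΓD ∧
    tensorOp (timeSpace N d) Pt Px u ∈ trialSpace (femSpace ΓD T p) (timeSpace N d) ∧
    halfNorm sinL (valQ (u - uj)) ≤
      2 * halfNorm sinL (valQ (u - tensorOp (timeSpace N d) Pt Px u))
        + dualHalfNorm (g - tensorOp (timeSpace N d) Pt LinearMap.id g) := by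
  have hSt := timeSpace_le_halfSpace N d
  exact ⟨trialSpace_le_trialQ _ hSt, tensorOp_mem_trialSpace _ Pt (fun z => (hPx z).1) u,
    halfNorm_sub_galerkin_le hA hu hg hSt huj Pt hPx⟩
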